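/- \textbf{Regret of the dual-based PID controller.} \emph{Requests.} Fix $m$ resources and constants $\bar f,\bar b\ge 0$. A request is $\gamma=(f,b,\mathcal X)$ with $\mathcal X\subset\mathbb R^d_+$ compact, $f:\mathcal X\to\mathbb R$, $b:\mathcal X\to\mathbb R^m$. A set $\mathcal S$ of requests is regular if for all $(f,b,\mathcal X)\in\mathcal S$: $0\in\mathcal X$ and $b(0)=0$; $0\le f(x)\le\bar f$, $b(x)\ge0$ and $\|b(x)\|_\infty\le\bar b$ for all $x\in\mathcal X$; and $\max_{x\in\mathcal X}\{f(x)-\mu^\top b(x)\}$ is attained for all $\mu\ge0$. Given a horizon $T\ge1$ and resources $B_j=\rho_jT$ with fixed $\rho_j>0$, put $$\mathrm{OPT}(\gamma_1,\dots,\gamma_T)=\sup\Big\{\sum_{t=1}^Tf_t(x_t):\ x_t\in\mathcal X_t,\ \sum_{t=1}^Tb_t(x_t)\le B\Big\}.$$ \emph{Algorithm 1.} Let $\ell_j$ ($1\le j\le m$) be continuous, strictly increasing response functions on $(0,\infty)$, $\beta\in[0,1)$, and $K_P,K_I,K_D\ge0$ gains. Start with $\mu_1\ge0$, $B_1=B$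 and $g_0=0$. For $t=1,\dots,T$: choose $\tilde x_t\in\arg\max_{x\in\mathcal X_t}\{f_t(x)-\mu_t^\top b_t(x)\}$ (by any fixed measurable selection); let $x_t=\tilde x_t$ if $b_t(\tilde x_t)\le B_t$ and $x_t=0$ otherwise; let $B_{t+1}=B_t-b_t(x_t)$, $g_t=B/T-b_t(x_t)$ and $$\mu_{t+1,j}=\max\Big(\ell_j^{-1}\Big(\ell_j(\mu_{t,j})-K_Pg_{t,j}-K_I\sum_{s=0}^{t-1}\beta^sg_{t-s,j}-K_D(g_{t,j}-g_{t-1,j})\Big),0\Big),$$ where $\ell_j^{-1}(y):=0$ if $y$ is below the range of $\ell_j$. The step-size is $\eta=K_P+K_I/(1-\beta)+K_D>0$, and $\alpha_I=K_I/(\eta(1-\beta))$, $\alpha_D=K_D/\eta$; thus $K_P=(1-\alpha_I-\alpha_D)\eta$. The regret of the algorithm is $\mathrm{Regret}(A)=\sup_P\mathbb E_{(\gamma_1,\dots,\gamma_T)\sim P^T}\big[\mathrm{OPT}(\gamma_1,\dots,\gamma_T)-\sum_{t=1}^Tf_t(x_t)\big]$, the supremum being over all probability distributions $P$ on $\mathcal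 S$. \emph{Reference function.} Let $h(\mu)=\sum_jh_j(\mu_j)$ with $h_j:[0,\infty)\to\mathbb R$ and $h_j'=\ell_j$, where each $h_j$ is either differentiable on $[0,\infty)$ or essentially smooth (continuous on $[0,\infty)$, differentiable on $(0,\infty)$, and $|h_j'(s)|\to\infty$ as $s\downarrow0$). Fix $\sigma>0$. The strong convexity assumption for a step-size $\eta$ is: for every $j$, $h_j$ is $\sigma$-strongly convex on $[0,\mu_j^{\max}]$, where $\mu_j^{\max}=\bar f/\rho_j+4\eta(\bar b+\rho_j)/(\sigma(1-\beta))$. \emph{Theorem.} Let $\beta\in[0,1)$, $\alpha_D,\alpha_I\ge0$, $\alpha_D<1$, $\alpha_D+\alpha_I\le1$ and $(\alpha_D+\beta(1-\alpha_I))^2\ge4\alpha_D\beta(1-\alpha_I\beta)$. Let $0\le\mu_{1,j}\le\bar f/\rho_j$ for all $j$, with $\mu_{1,j}>0$ whenever $h_j$ is not differentiable at $0$. Then $\eta=\Theta(T^{-1/2})$ implies $\mathrm{Regret}(A)=O(T^{1/2})$: for all $0<c_1\le c_2$ there is a constant $C$, depending only on $c_1,c_2$ and on $m,\bar f,\bar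 b,\rho,h,\sigma,\alpha_I,\alpha_D,\beta,\mu_1$, such that for every $T\ge1$, every $\eta\in[c_1T^{-1/2},c_2T^{-1/2}]$ for which the strong convexity assumption holds, and every regular set $\mathcal S$ of requests, $$\mathrm{Regret}(A)\le C\,T^{1/2}.$$ -/

import Mathlib

open Set Filter Topology MeasureTheory

noncomputable section

namespace OnlineAllocation

/-- A request `(f, b, 𝒳)`: a feasible set `𝒳 ⊆ ℝᵈ`, a reward function `f` and a resource
consumption function `b` with values in `ℝᵐ` (only their values on `𝒳` matter). -/
structure Request (d m : ℕ) where
  feasible : Set (Fin d → ℝ)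
  reward : (Fin d → ℝ) → ℝ
  consumption : (Fin d → ℝ) → Fin m → ℝ

variable {d m : ℕ}

/-- The opportunity-cost-adjusted reward `f(x) - μᵀ b(x)`. -/
def Request.adjusted (γ : Request d m) (μ : Fin m → ℝ) (x : Fin d → ℝ) : ℝ :=
  γ.reward x - ∑ j, μ j * γ.consumption x j

/-- Regularity of a request, with reward bound `fbar` and consumption bound `bbar`.
The norm on `Fin m → ℝ` is the sup norm. -/
structure Request.IsRegular (fbar bbar : ℝ) (γ : Request d m) : Prop where
  isCompact : IsCompact γ.feasible
  nonneg : ∀ x ∈ γ.feasible, 0 ≤ x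
  zero_mem : (0 : Fin d → ℝ) ∈ γ.feasible
  consumption_zero : γ.consumption 0 = 0
  reward_nonneg : ∀ x ∈ γ.feasible, 0 ≤ γ.reward x
  reward_le : ∀ x ∈ γ.feasible, γ.reward x ≤ fbar
  consumption_nonneg : ∀ x ∈ γ.feasible, 0 ≤ γ.consumption x
  consumption_le : ∀ x ∈ γ.feasible, ‖γ.consumption x‖ ≤ bbar
  exists_max : ∀ μ : Fin m → ℝ, 0 ≤ μ → ∃ x ∈ γ.feasible, IsMaxOn (γ.adjusted μ) γ.feasible x

/-- The offline optimum: the supremum of the total reward over all feasible action sequences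
whose total consumption is at most `B` (componentwise). -/
def offlineOpt {T : ℕ} (B : Fin m → ℝ) (γ : Fin T → Request d m) : ℝ :=
  sSup {v | ∃ x : Fin T → Fin d → ℝ, (∀ t, x t ∈ (γ t).feasible) ∧
    ∑ t, (γ t).consumption (x t) ≤ B ∧ v = ∑ t, (γ t).reward (x t)}

/-- The inverse of an increasing response function `ℓ` on `(0, ∞)`. It is the true inverse on the
range of `ℓ`, and `0` for a value below that range (see the two lemmas that follow). -/
def responseInv (ℓ : ℝ → ℝ) (y : ℝ) : ℝ := sInf {s | 0 < s ∧ y ≤ ℓ s}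

theorem responseInv_apply {ℓ : ℝ → ℝ} (hℓ : StrictMonoOn ℓ (Ioi 0)) {s : ℝ} (hs : 0 < s) :
    responseInv ℓ (ℓ s) = s := by
  have h : {u | 0 < u ∧ ℓ s ≤ ℓ u} = Ici s := by
    ext u
    constructor
    · rintro ⟨hu, h⟩
      exact (hℓ.le_iff_le hs hu).1 h
    · intro h
      have hu : 0 < u := lt_of_lt_of_le hs h
      exact ⟨hu, (hℓ.le_iff_le hs hu).2 h⟩
  rw [responseInv, h, csInf_Ici]

theorem responseInv_of_le {ℓ : ℝ → ℝ} {y : ℝ} (hy : ∀ s, 0 < s → y ≤ ℓ s) :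
    responseInv ℓ y = 0 := by
  have h : {u | 0 < u ∧ y ≤ ℓ u} = Ioi 0 := by
    ext u
    exact ⟨fun h => h.1, fun h => ⟨h, hy u h⟩⟩
  rw [responseInv, h, csInf_Ioi]

/-- The input of the dual-based PID controller: horizon, initial resources, gains, averaging
parameter, initial dual solution and response functions. -/
structure PIDInput (m : ℕ) where
  T : ℕ
  B : Fin m → ℝ
  KP : ℝ
  KI : ℝ
  KD : ℝ
  β : ℝ
  μ₁ : Fin m → ℝ
  ℓ : Fin m → ℝ → ℝ

/-- The state of the controller: current dual variable, remaining resources, and the errors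
`g_1, g_2, …` observed so far (`0` at the other indices, in particular `g_0 = 0`). -/
structure State (m : ℕ) where
  μ : Fin m → ℝ
  budget : Fin m → ℝ
  err : ℕ → Fin m → ℝ

/-- `sel` picks, for every request in `𝒮` and every `μ ≥ 0`, a maximizer over the feasible set of
`f(x) - μᵀ b(x)`; it is the tie-breaking rule in the `arg max` of the controller. -/
def IsSelection (𝒮 : Set (Request d m))
    (sel : Request d m → (Fin m → ℝ) → Fin d → ℝ) : Prop :=
  ∀ γ ∈ 𝒮, ∀ μ : Fin m → ℝ, 0 ≤ μ →
    sel γ μ ∈ γ.feasible ∧ IsMaxOn (γ.adjusted μ) γ.feasible (sel γ μ)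

open Classical in
/-- The action taken: the selected maximizer if the remaining resources allow it, else `0`. -/
def action (sel : Request d m → (Fin m → ℝ) → Fin d → ℝ) (γ : Request d m) (s : State m) :
    Fin d → ℝ :=
  if γ.consumption (sel γ s.μ) ≤ s.budget then sel γ s.μ else 0

/-- One iteration of the controller, at time `t ≥ 1`, on the request `γ`. -/
def step (A : PIDInput m) (sel : Request d m → (Fin m → ℝ) → Fin d → ℝ) (t : ℕ)
    (γ : Request d m) (s : State m) : State m :=
  let b : Fin m → ℝ := γ.consumption (action sel γ s)
  let g : ℕ → Fin m → ℝ := Function.update s.err t (fun j => A.B j / A.T - b j)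
  { μ := fun j => max (responseInv (A.ℓ j) (A.ℓ j (s.μ j) - A.KP * g t j
      - A.KI * ∑ i ∈ Finset.range t, A.β ^ i * g (t - i) j
      - A.KD * (g t j - g (t - 1) j))) 0
    budget := s.budget - b
    err := g }

/-- The state before the request with index `t` is processed (requests are indexed by
`0, …, T - 1`, so that the request with index `t` arrives at time `t + 1`). -/
def state (A : PIDInput m) (sel : Request d m → (Fin m → ℝ) → Fin d → ℝ)
    (γ : Fin A.T → Request d m) : Fin (A.T + 1) → State m :=
  Fin.induction (motive := fun _ => State m)
    { μ := A.μ₁, budget := A.B, err := fun _ => 0 }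
    (fun t s => step A sel (t.val + 1) (γ t) s)

/-- The total reward collected by the controller on a sequence of requests. -/
def totalReward (A : PIDInput m) (sel : Request d m → (Fin m → ℝ) → Fin d → ℝ)
    (γ : Fin A.T → Request d m) : ℝ :=
  ∑ t, (γ t).reward (action sel (γ t) (state A sel γ t.castSucc))

/-- The difference between the offline optimum and the reward of the controller. -/
def gap (A : PIDInput m) (sel : Request d m → (Fin m → ℝ) → Fin d → ℝ)
    (γ : Fin A.T → Request d m) : ℝ :=
  offlineOpt A.B γ - totalReward A sel γ

/-- The regret of the controller: the supremum, over all probability distributions `P` on the set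
`𝒮` of requests, of the expected gap when the requests are drawn from `P ^ T`. -/
def regret (A : PIDInput m) (sel : Request d m → (Fin m → ℝ) → Fin d → ℝ)
    (𝒮 : Set (Request d m)) [MeasurableSpace 𝒮] : EReal :=
  ⨆ P : ProbabilityMeasure 𝒮,
    ((∫ γ : Fin A.T → 𝒮, gap A sel (fun t => (γ t : Request d m))
      ∂(Measure.pi fun _ => (P : Measure 𝒮)) : ℝ) : EReal)

/-- `h : [0, ∞) → ℝ` is a univariate reference function with derivative `ℓ`: it is either
differentiable on `[0, ∞)` (one-sidedly at `0`), or essentially smooth, i.e. continuous on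
`[0, ∞)`, differentiable on `(0, ∞)`, with `|h'(s)| → ∞` as `s → 0+`. -/
def IsReference (h ℓ : ℝ → ℝ) : Prop :=
  (∀ s, 0 ≤ s → HasDerivWithinAt h (ℓ s) (Ici 0) s) ∨
  (ContinuousOn h (Ici 0) ∧ (∀ s, 0 < s → HasDerivAt h (ℓ s) s) ∧
    Tendsto (fun s => |ℓ s|) (𝓝[>] 0) atTop)

/-- The right end point `f̄ / ρ + 4 η (b̄ + ρ) / (σ (1 - β))` of the interval on which strong
convexity is required. -/
def muMax (fbar bbar σ β η ρ : ℝ) : ℝ := fbar / ρ + 4 * η * (bbar + ρ) / (σ * (1 - β))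

/-- The controller with horizon `T`, resources `B_j = ρ_j T`, step size `η`, and gains
`K_P = α_P η`, `K_I = α_I (1 - β) η`, `K_D = α_D η`, where `α_P = 1 - α_I - α_D`. These are the
gains with `η = K_P + K_I / (1 - β) + K_D`, `α_I = K_I / (η (1 - β))` and `α_D = K_D / η`. -/
def pidInput (ρ : Fin m → ℝ) (ℓ : Fin m → ℝ → ℝ) (αI αD β : ℝ) (μ₁ : Fin m → ℝ) (T : ℕ) (η : ℝ) :
    PIDInput m where
  T := T
  B := fun j => ρ j * T
  KP := (1 - αI - αD) * η
  KI := αI * (1 - β) * η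
  KD := αD * η
  β := β
  μ₁ := μ₁
  ℓ := ℓ

end OnlineAllocation

end

/-! The PID gradient is a multiple of the current error plus a telescoping term. Let `g t` be the
error of the request with index `t`, `J (t+1) = g t + β * J t` the discounted error sum, and `w t =
αD * g (t-1) - αI * β * J t`. The quantity subtracted from `ℓ (μ t)` is then `η * ((1 - αD) * g t +
(w (t+1) - w t))`, with `w` bounded uniformly in time (`dualPath`). So the controller is dual mirror
descent perturbed by the increments of a bounded sequence. Since `μ` moves by `O(η)` per step,
summation by parts makes the perturbation harmless, and the errors have the usual regret `O(1/η +
Tη)` against a fixed dual price (`DualPath.regret_le`). Strong convexity is only available on a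
bounded interval. The iterates stay there because a price above `fbar / ρ` forces consumption of at
most `ρ`, so that `ℓ (μ t) + η * w t` cannot grow (`DualPath.invariant`).

On the primal side, as long as `bbar` of every resource is left, the selected maximizer is played,
and the reward is the dual integrand at `μ t` minus the slackness term `∑ μ (ρ - b)`. Regret against
price `0` bounds the slackness. If resource `k` runs low at time `τ`, comparing with the price `fbar
/ ρ k` instead gains `(T - τ) * fbar` up to a constant, which pays for all later rounds
(`sum_slackness_le`).

Finally, the state before a request is independent of it, so by weak duality each dual integrand has
mean at least the expected optimum divided by `T` (`integral_offlineOpt_le_dual`,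
`le_integral_pi_of_forall_update`). Summing over time gives the bound. -/

namespace OnlineAllocation

/-! ### Strong convexity and the inverse response -/

section ReferenceFunction

variable {h ℓ : ℝ → ℝ} {σ M : ℝ}

theorem IsReference.hasDerivWithinAt (href : IsReference h ℓ) {s : ℝ} (hs : 0 < s) :
    HasDerivWithinAt h (ℓ s) (Ici 0) s := by
  rcases href with h1 | ⟨-, h2, -⟩
  · exact h1 s hs.le
  · exact (h2 s hs).hasDerivWithinAt

/-- The strong convexity inequality at a point where `h` has a derivative. -/
theorem add_sq_le_of_strongConvexOn (hsc : StrongConvexOn (Icc 0 M) σ h) {x y l : ℝ}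
    (hx : x ∈ Icc 0 M) (hy : y ∈ Icc 0 M) (hd : HasDerivWithinAt h l (Ici 0) x) :
    h x + l * (y - x) + σ / 2 * (y - x) ^ 2 ≤ h y := by
  rw [strongConvexOn_iff_convex] at hsc
  simp only [Real.norm_eq_abs, sq_abs] at hsc
  have hd' : HasDerivWithinAt (fun s => h s - σ / 2 * s ^ 2) (l - σ * x) (Icc 0 M) x := by
    have h2 : HasDerivAt (fun s : ℝ => σ / 2 * s ^ 2) (σ * x) x := by
      refine ((hasDerivAt_pow 2 x).const_mul (σ / 2)).congr_deriv ?_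
      norm_num
      ring
    exact (hd.mono Icc_subset_Ici_self).sub h2.hasDerivWithinAt
  rcases lt_trichotomy x y with hxy | rfl | hxy
  · have := hsc.le_slope_of_hasDerivWithinAt hx hy hxy hd'
    rw [slope_def_field, le_div_iff₀ (sub_pos.2 hxy)] at this
    nlinarith
  · simp
  · have := hsc.slope_le_of_hasDerivWithinAt hy hx hxy hd'
    rw [slope_def_field, div_le_iff₀ (sub_pos.2 hxy)] at this
    nlinarith

theorem mul_sq_le_of_strongConvexOn (hsc : StrongConvexOn (Icc 0 M) σ h) {x y : ℝ}
    (hx : x ∈ Icc 0 M) (hy : y ∈ Icc 0 M) (hdx : HasDerivWithinAt h (ℓ x) (Ici 0) x)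
    (hdy : HasDerivWithinAt h (ℓ y) (Ici 0) y) :
    σ * (y - x) ^ 2 ≤ (ℓ y - ℓ x) * (y - x) := by
  have h1 := add_sq_le_of_strongConvexOn hsc hx hy hdx
  have h2 := add_sq_le_of_strongConvexOn hsc hy hx hdy
  nlinarith

/-- Optimality conditions for the mirror step: `p = responseInv ℓ y` satisfies `ℓ p = y`, or else
`p = 0` and `y ≤ ℓ 0`. -/
theorem responseInv_spec (hmono : StrictMonoOn ℓ (Ioi 0)) (hcont : ContinuousOn ℓ (Ioi 0))
    (href : IsReference h ℓ) (hM : 0 < M) {y : ℝ} (hy : y ≤ ℓ M) :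
    responseInv ℓ y ∈ Icc 0 M ∧
      HasDerivWithinAt h (ℓ (responseInv ℓ y)) (Ici 0) (responseInv ℓ y) ∧
      y ≤ ℓ (responseInv ℓ y) ∧ (responseInv ℓ y = 0 ∨ ℓ (responseInv ℓ y) = y) := by
  by_cases hs : ∃ s, 0 < s ∧ ℓ s ≤ y
  -- The bound `y ≤ ℓ M` keeps `y` from lying above the range of `ℓ`, where `responseInv` would
  -- return the infimum of the empty set.
  · obtain ⟨s, hs0, hsy⟩ := hs
    have hsM : s ≤ M := (hmono.le_iff_le hs0 hM).1 (hsy.trans hy)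
    obtain ⟨p, hp, rfl⟩ := intermediate_value_Icc hsM
      (hcont.mono fun u hu => lt_of_lt_of_le hs0 hu.1) ⟨hsy, hy⟩
    have hp0 : 0 < p := lt_of_lt_of_le hs0 hp.1
    rw [responseInv_apply hmono hp0]
    exact ⟨⟨hp0.le, hp.2⟩, href.hasDerivWithinAt hp0, le_rfl, Or.inr rfl⟩
  · push Not at hs
    rw [responseInv_of_le fun s h0 => (hs s h0).le]
    rcases href with h1 | ⟨-, -, h2⟩
    · refine ⟨⟨le_rfl, hM.le⟩, h1 0 le_rfl, ?_, Or.inl rfl⟩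
      have hc : ContinuousOn h (Ici 0) := fun s h0 => (h1 s h0).continuousWithinAt
      have hda : ∀ s, 0 < s → HasDerivAt h (ℓ s) s := fun s h0 =>
        (h1 s h0.le).hasDerivAt (Ici_mem_nhds h0)
      -- By the mean value inequality all slopes of `h` from `0` are at least `y`, hence so is their
      -- limit `ℓ 0`. Continuity of `ℓ` at `0` is not needed.
      have hslope : ∀ s ∈ Ioi (0 : ℝ), y ≤ slope h 0 s := by
        intro s (h0 : 0 < s)
        have := (convex_Ici (0 : ℝ)).mul_sub_le_image_sub_of_le_deriv hc
          (fun u hu => by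
            rw [interior_Ici] at hu
            exact (hda u hu).differentiableAt.differentiableWithinAt)
          (C := y) (fun u hu => by
            rw [interior_Ici] at hu
            rw [(hda u hu).deriv]
            exact (hs u hu).le) 0 self_mem_Ici s h0.le h0.le
        rw [slope_def_field, le_div_iff₀ (by linarith)]
        exact this
      have hd := (h1 0 le_rfl).mono Ioi_subset_Ici_self
      rw [hasDerivWithinAt_iff_tendsto_slope' self_notMem_Ioi] at hd
      exact ge_of_tendsto hd (eventually_nhdsWithin_of_forall hslope)
    -- For an essentially smooth `h`, nothing lies below the range: `ℓ` would be trapped between `y`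
    -- and `ℓ 1` near `0`, although `|ℓ|` blows up there.
    · exfalso
      have hb : ∀ᶠ s in 𝓝[>] (0 : ℝ), |ℓ s| ≤ max |ℓ 1| |y| := by
        filter_upwards [Ioo_mem_nhdsGT (zero_lt_one' ℝ)] with s hs1
        have := hmono hs1.1 (show (0 : ℝ) < 1 by norm_num) hs1.2
        exact abs_le_max_abs_abs (hs s hs1.1).le this.le |>.trans (max_comm _ _).le
      obtain ⟨s, hs1, hs2⟩ := (hb.and (h2.eventually_gt_atTop (max |ℓ 1| |y|))).exists
      exact absurd hs1 (not_le.2 hs2)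

end ReferenceFunction

/-! ### Mirror descent with a telescoping perturbation -/

/-- One coordinate of the dual variables of the controller. The gradient fed to the mirror step is
`κ * g t + (w (t + 1) - w t)`: a multiple of the error plus the increment of a bounded sequence. -/
structure DualPath (h ℓ : ℝ → ℝ) (σ η κ F M G W : ℝ) (T : ℕ) (μ g w : ℕ → ℝ) : Prop where
  strictMonoOn : StrictMonoOn ℓ (Ioi 0)
  continuousOn : ContinuousOn ℓ (Ioi 0)
  isReference : IsReference h ℓ
  strongConvexOn : StrongConvexOn (Icc 0 M) σ h
  sigma_pos : 0 < σ
  eta_pos : 0 < η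
  kappa_nonneg : 0 ≤ κ
  kappa_le_one : κ ≤ 1
  F_nonneg : 0 ≤ F
  G_pos : 0 < G
  W_nonneg : 0 ≤ W
  margin : η * (G + 2 * W) ≤ σ * (M - F)
  init_nonneg : 0 ≤ μ 0
  init_le : μ 0 ≤ F
  init_deriv : HasDerivWithinAt h (ℓ (μ 0)) (Ici 0) (μ 0)
  step : ∀ t < T, μ (t + 1) = max (responseInv ℓ (ℓ (μ t) - η * (κ * g t + (w (t + 1) - w t)))) 0
  g_abs : ∀ t < T, |g t| ≤ G
  w_zero : w 0 = 0
  w_abs : ∀ t ≤ T, |w t| ≤ W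
  g_nonneg : ∀ t < T, F < μ t → 0 ≤ g t

namespace DualPath

variable {h ℓ : ℝ → ℝ} {σ η κ F M G W : ℝ} {T : ℕ} {μ g w : ℕ → ℝ}

theorem F_lt_M (P : DualPath h ℓ σ η κ F M G W T μ g w) : F < M := by
  have h1 : 0 < η * (G + 2 * W) := mul_pos P.eta_pos (by linarith [P.G_pos, P.W_nonneg])
  have h2 := pos_of_mul_pos_right (h1.trans_le P.margin) P.sigma_pos.le
  linarith

/-- Strong convexity makes `ℓ` rise by at least `σ * (M - F)` between a point of `[0, F]` and `M`;
`margin` says that this covers the largest possible overshoot. -/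
theorem le_apply_M (P : DualPath h ℓ σ η κ F M G W T μ g w) {x y : ℝ} (hx0 : 0 ≤ x) (hxF : x ≤ F)
    (hd : HasDerivWithinAt h (ℓ x) (Ici 0) x) (hy : y ≤ ℓ x + η * (G + 2 * W)) : y ≤ ℓ M := by
  have hFM := P.F_lt_M
  have hM : 0 < M := P.F_nonneg.trans_lt hFM
  have h1 := mul_sq_le_of_strongConvexOn P.strongConvexOn ⟨hx0, hxF.trans hFM.le⟩ ⟨hM.le, le_rfl⟩
    hd (P.isReference.hasDerivWithinAt hM)
  have h2 : 0 < M - x := by linarith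
  have h3 : σ * (M - x) ≤ ℓ M - ℓ x := by
    refine le_of_mul_le_mul_right ?_ h2
    linarith
  have h4 := P.margin
  have h5 : σ * (M - F) ≤ σ * (M - x) := mul_le_mul_of_nonneg_left (by linarith) P.sigma_pos.le
  linarith

/-- The dual variables stay in `[0, M]`: the error is nonnegative above `F`, so they overshoot `F`
by a bounded amount only. -/
theorem invariant (P : DualPath h ℓ σ η κ F M G W T μ g w) : ∀ t ≤ T,
    μ t ∈ Icc 0 M ∧ HasDerivWithinAt h (ℓ (μ t)) (Ici 0) (μ t) ∧
      ∃ x, 0 ≤ x ∧ x ≤ F ∧ HasDerivWithinAt h (ℓ x) (Ici 0) x ∧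
        (μ t ≤ F ∨ ℓ (μ t) ≤ ℓ x + η * (G + W - w t)) ∧
        (t < T → ℓ (μ t) - η * (κ * g t + (w (t + 1) - w t))
          ≤ ℓ x + η * (G + W - w (t + 1))) := by
  have hFM := P.F_lt_M
  have hη := P.eta_pos
  have hM : 0 < M := P.F_nonneg.trans_lt hFM
  -- An anchor `x` in `[0, F]` is carried along. It is reset to `μ t` whenever `μ t ≤ F`, and the
  -- allowance `G + W` covers the step leaving it. Above `F` the error is nonnegative, so `ℓ (μ t) +
  -- η * w t` does not increase and the old anchor still serves.
  have key : ∀ t ≤ T, 0 ≤ μ t → HasDerivWithinAt h (ℓ (μ t)) (Ici 0) (μ t) →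
      (∃ x, 0 ≤ x ∧ x ≤ F ∧ HasDerivWithinAt h (ℓ x) (Ici 0) x ∧
        (μ t ≤ F ∨ ℓ (μ t) ≤ ℓ x + η * (G + W - w t))) →
      ∃ x, 0 ≤ x ∧ x ≤ F ∧ HasDerivWithinAt h (ℓ x) (Ici 0) x ∧
        (μ t ≤ F ∨ ℓ (μ t) ≤ ℓ x + η * (G + W - w t)) ∧
        (t < T → ℓ (μ t) - η * (κ * g t + (w (t + 1) - w t))
          ≤ ℓ x + η * (G + W - w (t + 1))) := by
    rintro t ht h0 hd ⟨x, hx0, hxF, hdx, hx⟩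
    by_cases hF : μ t ≤ F
    · refine ⟨μ t, h0, hF, hd, Or.inl hF, fun htT => ?_⟩
      have h1 := abs_le.1 (P.g_abs t htT)
      have h2 := abs_le.1 (P.w_abs t ht)
      have h3 : -(κ * g t) ≤ G := by nlinarith [P.kappa_nonneg, P.kappa_le_one, P.G_pos]
      have h4 : η * -(κ * g t + (w (t + 1) - w t)) ≤ η * (G + W - w (t + 1)) :=
        mul_le_mul_of_nonneg_left (by linarith) hη.le
      linarith
    · refine ⟨x, hx0, hxF, hdx, hx, fun htT => ?_⟩
      have h1 := P.g_nonneg t htT (not_le.1 hF)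
      have h2 := hx.resolve_left hF
      have h3 : 0 ≤ η * (κ * g t) := mul_nonneg hη.le (mul_nonneg P.kappa_nonneg h1)
      linarith
  intro t
  induction t with
  | zero =>
    intro ht
    exact ⟨⟨P.init_nonneg, P.init_le.trans hFM.le⟩, P.init_deriv,
      key 0 ht P.init_nonneg P.init_deriv
        ⟨μ 0, P.init_nonneg, P.init_le, P.init_deriv, Or.inl P.init_le⟩⟩
  | succ t ih =>
    intro ht
    obtain ⟨-, -, x, hx0, hxF, hdx, -, hx⟩ := ih (by omega)
    replace hx := hx (by omega)
    have hw := abs_le.1 (P.w_abs (t + 1) ht)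
    have hy : ℓ (μ t) - η * (κ * g t + (w (t + 1) - w t)) ≤ ℓ M := by
      refine P.le_apply_M hx0 hxF hdx (hx.trans ?_)
      have : η * (G + W - w (t + 1)) ≤ η * (G + 2 * W) :=
        mul_le_mul_of_nonneg_left (by linarith) hη.le
      linarith
    obtain ⟨hI, hd, -, hor⟩ := responseInv_spec P.strictMonoOn P.continuousOn P.isReference hM hy
    have hμ := P.step t (by omega)
    rw [max_eq_left hI.1] at hμ
    rw [← hμ] at hI hd hor
    refine ⟨hI, hd, key (t + 1) ht hI.1 hd ⟨x, hx0, hxF, hdx, ?_⟩⟩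
    rcases hor with h0 | h1
    · left
      rw [h0]
      exact P.F_nonneg
    · right
      rw [h1]
      exact hx

theorem mem_Icc (P : DualPath h ℓ σ η κ F M G W T μ g w) {t : ℕ} (ht : t ≤ T) :
    μ t ∈ Icc 0 M := (P.invariant t ht).1

/-- The variational inequality satisfied by the mirror step. -/
theorem variational (P : DualPath h ℓ σ η κ F M G W T μ g w) {t : ℕ} (ht : t < T) {u : ℝ}
    (hu : 0 ≤ u) :
    0 ≤ (ℓ (μ (t + 1)) - (ℓ (μ t) - η * (κ * g t + (w (t + 1) - w t)))) * (u - μ (t + 1)) := by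
  have hM : 0 < M := P.F_nonneg.trans_lt P.F_lt_M
  obtain ⟨-, -, x, hx0, hxF, hdx, -, hx⟩ := P.invariant t ht.le
  have hw := abs_le.1 (P.w_abs (t + 1) ht)
  have hy : ℓ (μ t) - η * (κ * g t + (w (t + 1) - w t)) ≤ ℓ M := by
    refine P.le_apply_M hx0 hxF hdx ((hx ht).trans ?_)
    have : η * (G + W - w (t + 1)) ≤ η * (G + 2 * W) :=
      mul_le_mul_of_nonneg_left (by linarith) P.eta_pos.le
    linarith
  obtain ⟨hI, -, hle, hor⟩ := responseInv_spec P.strictMonoOn P.continuousOn P.isReference hM hy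
  have hμ := P.step t ht
  rw [max_eq_left hI.1] at hμ
  rw [← hμ] at hle hor
  rcases hor with h0 | h1
  · exact mul_nonneg (by linarith) (by linarith)
  · rw [h1]
    simp

theorem abs_gradient_le (P : DualPath h ℓ σ η κ F M G W T μ g w) {t : ℕ} (ht : t < T) :
    |κ * g t + (w (t + 1) - w t)| ≤ G + 2 * W := by
  have h1 : |κ * g t| ≤ G := by
    rw [abs_mul, abs_of_nonneg P.kappa_nonneg]
    nlinarith [P.g_abs t ht, P.kappa_le_one, P.kappa_nonneg, P.G_pos, abs_nonneg (g t)]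
  have h2 := P.w_abs (t + 1) ht
  have h3 := P.w_abs t ht.le
  have h4 := abs_add_le (κ * g t) (w (t + 1) - w t)
  have h5 := abs_sub (w (t + 1)) (w t)
  linarith

/-- The variational inequality tested at `u = μ t`, combined with strong monotonicity of `ℓ`, bounds
`σ` times the squared step by `η` times gradient times step; one factor cancels. -/
theorem abs_step_le (P : DualPath h ℓ σ η κ F M G W T μ g w) {t : ℕ} (ht : t < T) :
    |μ (t + 1) - μ t| ≤ η * (G + 2 * W) / σ := by
  have hI := P.invariant t ht.le
  have hI' := P.invariant (t + 1) ht
  have h1 := mul_sq_le_of_strongConvexOn P.strongConvexOn hI.1 hI'.1 hI.2.1 hI'.2.1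
  have h2 := P.variational ht hI.1.1
  have h3 := P.abs_gradient_le ht
  have h4 := neg_abs_le ((κ * g t + (w (t + 1) - w t)) * (μ (t + 1) - μ t))
  rw [abs_mul] at h4
  have h5 : |κ * g t + (w (t + 1) - w t)| * |μ (t + 1) - μ t|
      ≤ (G + 2 * W) * |μ (t + 1) - μ t| := mul_le_mul_of_nonneg_right h3 (abs_nonneg _)
  have h6 := mul_le_mul_of_nonneg_left (neg_le_neg_iff.2 h5 |>.trans h4) P.eta_pos.le
  rw [← sq_abs] at h1
  rw [le_div_iff₀ P.sigma_pos]
  rcases (abs_nonneg (μ (t + 1) - μ t)).eq_or_lt with h0 | h0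
  · rw [← h0, zero_mul]
    exact mul_nonneg P.eta_pos.le (by linarith [P.G_pos, P.W_nonneg])
  · refine le_of_mul_le_mul_right ?_ h0
    linarith

/-- The regret bound for convolutional mirror descent. -/
theorem regret_aux (P : DualPath h ℓ σ η κ F M G W T μ g w) {u : ℝ} (hu : u ∈ Icc 0 M) :
    ∀ n ≤ T, η * (κ * ∑ t ∈ Finset.range n, g t * (μ t - u))
      ≤ (h u - h (μ 0) - ℓ (μ 0) * (u - μ 0)) - (h u - h (μ n) - ℓ (μ n) * (u - μ n))
        - η * (w n * (μ n - u)) + n * (η ^ 2 * ((G + 2 * W) * (G + 3 * W) / σ)) := by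
  intro n
  induction n with
  | zero => simp [P.w_zero]
  | succ t ih =>
    intro ht
    specialize ih (by omega)
    rw [Finset.sum_range_succ]
    have ht' : t < T := ht
    have hI := P.invariant t ht'.le
    have hI' := P.invariant (t + 1) ht
    have h1 := P.variational ht' hu.1
    have h2 := add_sq_le_of_strongConvexOn P.strongConvexOn hI.1 hI'.1 hI.2.1
    have h3 : 0 ≤ σ / 2 * (μ (t + 1) - μ t) ^ 2 := mul_nonneg (half_pos P.sigma_pos).le (sq_nonneg _)
    have hs := P.abs_step_le ht'
    -- Summation by parts: `(w (t+1) - w t) * (μ t - u)` is the increment of `w t * (μ t - u)` minus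
    -- `w (t+1) * (μ (t+1) - μ t)`. What remains is `O(η)` by the step length, with constant `(G +
    -- 2W)² + W (G + 2W)` over `σ`.
    have h4 : (κ * g t + (w (t + 1) - w t)) * (μ t - μ (t + 1)) + w (t + 1) * (μ (t + 1) - μ t)
        ≤ η * ((G + 2 * W) * (G + 3 * W) / σ) := by
      have e1 := le_abs_self ((κ * g t + (w (t + 1) - w t)) * (μ t - μ (t + 1)))
      have e2 := le_abs_self (w (t + 1) * (μ (t + 1) - μ t))
      rw [abs_mul, abs_sub_comm (μ t)] at e1
      rw [abs_mul] at e2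
      have e3 := mul_le_mul (P.abs_gradient_le ht') hs (abs_nonneg _)
        (by linarith [P.G_pos, P.W_nonneg])
      have e4 := mul_le_mul (P.w_abs (t + 1) ht) hs (abs_nonneg _) P.W_nonneg
      calc _ ≤ (G + 2 * W) * (η * (G + 2 * W) / σ) + W * (η * (G + 2 * W) / σ) := by linarith
        _ = _ := by ring
    have h5 := mul_le_mul_of_nonneg_left h4 P.eta_pos.le
    push_cast
    linarith

/-- In the telescoped bound the final Bregman divergence is nonnegative and drops out, and the
boundary term `w n * (μ n - u)` costs at most `W * M`. -/
theorem regret_le (P : DualPath h ℓ σ η κ F M G W T μ g w) {u : ℝ} (hu : u ∈ Icc 0 M) {n : ℕ}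
    (hn : n ≤ T) :
    κ * ∑ t ∈ Finset.range n, g t * (μ t - u)
      ≤ |h u - h (μ 0) - ℓ (μ 0) * (u - μ 0)| / η + W * M
        + n * η * ((G + 2 * W) * (G + 3 * W) / σ) := by
  have hη := P.eta_pos
  have h1 := P.regret_aux hu n hn
  have hI := P.invariant n hn
  have h2 := add_sq_le_of_strongConvexOn P.strongConvexOn hI.1 hu hI.2.1
  have h3 : 0 ≤ σ / 2 * (u - μ n) ^ 2 := mul_nonneg (half_pos P.sigma_pos).le (sq_nonneg _)
  have h4 : -(w n * (μ n - u)) ≤ W * M := by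
    have e1 := neg_le_abs (w n * (μ n - u))
    rw [abs_mul] at e1
    have e2 : |μ n - u| ≤ M := by
      rw [abs_le]
      constructor <;> linarith [hI.1.1, hI.1.2, hu.1, hu.2]
    exact e1.trans (mul_le_mul (P.w_abs n hn) e2 (abs_nonneg _) P.W_nonneg)
  have h5 := mul_le_mul_of_nonneg_left h4 hη.le
  have h6 := le_abs_self (h u - h (μ 0) - ℓ (μ 0) * (u - μ 0))
  refine le_of_mul_le_mul_left ?_ hη
  rw [mul_add, mul_add, mul_div_cancel₀ _ hη.ne']
  linarith

end DualPath

/-! ### Dynamics of the controller -/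

variable {d m : ℕ}

/-- The states of the controller, indexed by natural numbers; constant after the horizon. -/
noncomputable def trajectory (A : PIDInput m) (sel : Request d m → (Fin m → ℝ) → Fin d → ℝ)
    (γ : Fin A.T → Request d m) : ℕ → State m
  | 0 => { μ := A.μ₁, budget := A.B, err := fun _ => 0 }
  | t + 1 => if h : t < A.T then step A sel (t + 1) (γ ⟨t, h⟩) (trajectory A sel γ t)
      else trajectory A sel γ t

/-- The resources consumed by the request with index `t`. -/
noncomputable def spent (A : PIDInput m) (sel : Request d m → (Fin m → ℝ) → Fin d → ℝ)
    (γ : Fin A.T → Request d m) (t : ℕ) : Fin m → ℝ :=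
  if h : t < A.T then
    (γ ⟨t, h⟩).consumption (action sel (γ ⟨t, h⟩) (trajectory A sel γ t))
  else 0

/-- The discounted sum of the errors in the integral term, before the request with index `t`. -/
noncomputable def integralTerm (A : PIDInput m) (sel : Request d m → (Fin m → ℝ) → Fin d → ℝ)
    (γ : Fin A.T → Request d m) (t : ℕ) (j : Fin m) : ℝ :=
  ∑ i ∈ Finset.range t, A.β ^ i * (trajectory A sel γ t).err (t - i) j

section Trajectory

variable (A : PIDInput m) (sel : Request d m → (Fin m → ℝ) → Fin d → ℝ)
  (γ : Fin A.T → Request d m)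

theorem state_eq_trajectory (i : Fin (A.T + 1)) :
    state A sel γ i = trajectory A sel γ i := by
  induction i using Fin.induction with
  | zero => rfl
  | succ i ih =>
    rw [state, Fin.induction_succ, ← state, ih]
    simp [trajectory]

theorem trajectory_succ {t : ℕ} (h : t < A.T) :
    trajectory A sel γ (t + 1) = step A sel (t + 1) (γ ⟨t, h⟩) (trajectory A sel γ t) := by
  rw [trajectory, dif_pos h]

theorem spent_eq {t : ℕ} (h : t < A.T) : spent A sel γ t =
    (γ ⟨t, h⟩).consumption (action sel (γ ⟨t, h⟩) (trajectory A sel γ t)) := by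
  rw [spent, dif_pos h]

theorem trajectory_succ_budget {t : ℕ} (h : t < A.T) :
    (trajectory A sel γ (t + 1)).budget = (trajectory A sel γ t).budget - spent A sel γ t := by
  rw [trajectory_succ A sel γ h, spent_eq A sel γ h, step]

theorem trajectory_succ_err {t : ℕ} (h : t < A.T) :
    (trajectory A sel γ (t + 1)).err =
      Function.update (trajectory A sel γ t).err (t + 1)
        (fun j => A.B j / A.T - spent A sel γ t j) := by
  rw [trajectory_succ A sel γ h, spent_eq A sel γ h, step]

theorem trajectory_err_zero : ∀ t ≤ A.T, (trajectory A sel γ t).err 0 = 0 := by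
  intro t
  induction t with
  | zero => intro _; rfl
  | succ t ih =>
    intro h
    rw [trajectory_succ_err A sel γ h, Function.update_of_ne (by omega), ih (by omega)]

/-- This recursion is what lets the integral term be written as a current error plus an increment of
a bounded sequence. -/
theorem integralTerm_succ {t : ℕ} (h : t < A.T) (j : Fin m) :
    integralTerm A sel γ (t + 1) j =
      (A.B j / A.T - spent A sel γ t j) + A.β * integralTerm A sel γ t j := by
  rw [integralTerm, Finset.sum_range_succ', integralTerm, Finset.mul_sum,
    trajectory_succ_err A sel γ h, add_comm]
  congr 1
  · simp
  · refine Finset.sum_congr rfl fun i _ => ?_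
    rw [Nat.add_sub_add_right, Function.update_of_ne (by omega), pow_succ]
    ring

theorem trajectory_succ_μ {t : ℕ} (h : t < A.T) (j : Fin m) :
    (trajectory A sel γ (t + 1)).μ j =
      max (responseInv (A.ℓ j) (A.ℓ j ((trajectory A sel γ t).μ j)
        - A.KP * (A.B j / A.T - spent A sel γ t j)
        - A.KI * integralTerm A sel γ (t + 1) j
        - A.KD * (A.B j / A.T - spent A sel γ t j - (trajectory A sel γ t).err t j))) 0 := by
  rw [integralTerm, trajectory_succ_err A sel γ h, trajectory_succ A sel γ h,
    spent_eq A sel γ h]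
  simp [step]

theorem trajectory_μ_nonneg (hμ : 0 ≤ A.μ₁) : ∀ t ≤ A.T, 0 ≤ (trajectory A sel γ t).μ := by
  intro t ht j
  cases t with
  | zero => exact hμ j
  | succ t =>
    rw [trajectory_succ_μ A sel γ ht]
    exact le_max_right _ _

theorem trajectory_budget : ∀ t ≤ A.T,
    (trajectory A sel γ t).budget = A.B - ∑ s ∈ Finset.range t, spent A sel γ s := by
  intro t
  induction t with
  | zero => simp [trajectory]
  | succ t ih =>
    intro h
    rw [trajectory_succ_budget A sel γ h, ih (by omega), Finset.sum_range_succ, sub_sub]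

variable {A sel γ}

theorem action_of_le {r : Request d m} {s : State m} (h : r.consumption (sel r s.μ) ≤ s.budget) :
    action sel r s = sel r s.μ := by
  rw [action, if_pos h]

theorem action_of_not_le {r : Request d m} {s : State m}
    (h : ¬ r.consumption (sel r s.μ) ≤ s.budget) : action sel r s = 0 := by
  rw [action, if_neg h]

variable {𝒮 : Set (Request d m)} {fbar bbar : ℝ}

theorem action_mem_feasible (hreg : ∀ γ ∈ 𝒮, γ.IsRegular fbar bbar) (hsel : IsSelection 𝒮 sel)
    {r : Request d m} (hr : r ∈ 𝒮) {s : State m} (hs : 0 ≤ s.μ) :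
    action sel r s ∈ r.feasible := by
  by_cases h : r.consumption (sel r s.μ) ≤ s.budget
  · rw [action_of_le h]
    exact (hsel r hr s.μ hs).1
  · rw [action_of_not_le h]
    exact (hreg r hr).zero_mem

theorem Request.IsRegular.consumption_apply_le {r : Request d m} (hr : r.IsRegular fbar bbar)
    {x : Fin d → ℝ} (hx : x ∈ r.feasible) (j : Fin m) : r.consumption x j ≤ bbar :=
  (le_abs_self _).trans ((norm_le_pi_norm (r.consumption x) j).trans (hr.consumption_le x hx))

/-- The adjusted reward of the selected action is at least that of the zero action. -/
theorem adjusted_nonneg (hreg : ∀ γ ∈ 𝒮, γ.IsRegular fbar bbar) (hsel : IsSelection 𝒮 sel)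
    {r : Request d m} (hr : r ∈ 𝒮) {μ : Fin m → ℝ} (hμ : 0 ≤ μ) :
    0 ≤ r.adjusted μ (sel r μ) := by
  have h1 := (hsel r hr μ hμ).2 (hreg r hr).zero_mem
  have h2 : r.adjusted μ 0 = r.reward 0 := by
    simp [Request.adjusted, (hreg r hr).consumption_zero]
  exact ((hreg r hr).reward_nonneg 0 (hreg r hr).zero_mem).trans (h2 ▸ h1)

theorem adjusted_le (hreg : ∀ γ ∈ 𝒮, γ.IsRegular fbar bbar) (hsel : IsSelection 𝒮 sel)
    {r : Request d m} (hr : r ∈ 𝒮) {μ : Fin m → ℝ} (hμ : 0 ≤ μ) :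
    r.adjusted μ (sel r μ) ≤ fbar := by
  have hx := (hsel r hr μ hμ).1
  have h1 := (hreg r hr).reward_le _ hx
  have h2 : 0 ≤ ∑ j, μ j * r.consumption (sel r μ) j :=
    Finset.sum_nonneg fun j _ => mul_nonneg (hμ j) ((hreg r hr).consumption_nonneg _ hx j)
  rw [Request.adjusted]
  linarith

/-- A resource whose dual variable exceeds `fbar / ρ` is consumed at a rate of at most `ρ`. -/
theorem consumption_action_le (hreg : ∀ γ ∈ 𝒮, γ.IsRegular fbar bbar)
    (hsel : IsSelection 𝒮 sel) {r : Request d m} (hr : r ∈ 𝒮) {s : State m} (hs : 0 ≤ s.μ)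
    {ρ : ℝ} (hρ : 0 < ρ) {j : Fin m} (hj : fbar / ρ < s.μ j) :
    r.consumption (action sel r s) j ≤ ρ := by
  by_cases h : r.consumption (sel r s.μ) ≤ s.budget
  · rw [action_of_le h]
    have hx := (hsel r hr s.μ hs).1
    have h1 := adjusted_nonneg hreg hsel hr hs
    have h2 := (hreg r hr).reward_le _ hx
    have h3 : s.μ j * r.consumption (sel r s.μ) j ≤ ∑ k, s.μ k * r.consumption (sel r s.μ) k :=
      Finset.single_le_sum
        (f := fun k => s.μ k * r.consumption (sel r s.μ) k)
        (fun k _ => mul_nonneg (hs k) ((hreg r hr).consumption_nonneg _ hx k))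
        (Finset.mem_univ j)
    -- Since the zero action is available, `μ j * b j ≤ ∑ μ b ≤ f ≤ fbar < μ j * ρ`.
    rw [Request.adjusted] at h1
    rw [div_lt_iff₀ hρ] at hj
    by_contra hlt
    push Not at hlt
    have h4 := mul_le_mul_of_nonneg_left hlt.le (hs j)
    linarith
  · rw [action_of_not_le h, (hreg r hr).consumption_zero]
    exact hρ.le

variable (hreg : ∀ γ ∈ 𝒮, γ.IsRegular fbar bbar) (hsel : IsSelection 𝒮 sel)
  (hγ : ∀ t, γ t ∈ 𝒮) (hμ : 0 ≤ A.μ₁)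
include hreg hsel hγ hμ

theorem spent_nonneg {t : ℕ} (h : t < A.T) : 0 ≤ spent A sel γ t := by
  rw [spent_eq A sel γ h]
  exact (hreg _ (hγ _)).consumption_nonneg _
    (action_mem_feasible hreg hsel (hγ _) (trajectory_μ_nonneg A sel γ hμ t h.le))

theorem spent_le {t : ℕ} (h : t < A.T) (j : Fin m) : spent A sel γ t j ≤ bbar := by
  rw [spent_eq A sel γ h]
  exact (hreg _ (hγ _)).consumption_apply_le
    (action_mem_feasible hreg hsel (hγ _) (trajectory_μ_nonneg A sel γ hμ t h.le)) j

theorem trajectory_budget_anti {s t : ℕ} (hst : s ≤ t) (ht : t ≤ A.T) :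
    (trajectory A sel γ t).budget ≤ (trajectory A sel γ s).budget := by
  induction t, hst using Nat.le_induction with
  | base => exact le_rfl
  | succ t hst ih =>
    rw [trajectory_succ_budget A sel γ ht]
    exact (sub_le_self _ (spent_nonneg hreg hsel hγ hμ ht)).trans (ih (by omega))

end Trajectory

/-! ### The PID update as perturbed mirror descent -/

section Path

variable {fbar bbar : ℝ} {ρ : Fin m → ℝ} {h : Fin m → ℝ → ℝ} {σ αI αD η : ℝ}
  {A : PIDInput m}

/-- Each coordinate of the dual variables of the controller follows a convolutional mirror
descent. -/
theorem dualPath (hfbar : 0 ≤ fbar) (hbbar : 0 ≤ bbar) (hρ : ∀ j, 0 < ρ j)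
    (hmono : ∀ j, StrictMonoOn (A.ℓ j) (Ioi 0)) (hcont : ∀ j, ContinuousOn (A.ℓ j) (Ioi 0))
    (href : ∀ j, IsReference (h j) (A.ℓ j)) (hσ : 0 < σ)
    (hβ0 : 0 ≤ A.β) (hβ1 : A.β < 1) (hαI : 0 ≤ αI) (hαD : 0 ≤ αD) (hα : αD + αI ≤ 1)
    (hμ : 0 ≤ A.μ₁) (hμ1 : ∀ j, A.μ₁ j ≤ fbar / ρ j)
    (hμd : ∀ j, A.μ₁ j = 0 → HasDerivWithinAt (h j) (A.ℓ j 0) (Ici 0) 0)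
    (hη : 0 < η) (hBT : ∀ j, A.B j / A.T = ρ j) (hKP : A.KP = (1 - αI - αD) * η)
    (hKI : A.KI = αI * (1 - A.β) * η) (hKD : A.KD = αD * η)
    (hsc : ∀ j, StrongConvexOn (Icc 0 (muMax fbar bbar σ A.β η (ρ j))) σ (h j))
    {𝒮 : Set (Request d m)} (hreg : ∀ γ ∈ 𝒮, γ.IsRegular fbar bbar)
    {sel : Request d m → (Fin m → ℝ) → Fin d → ℝ} (hsel : IsSelection 𝒮 sel)
    {γ : Fin A.T → Request d m} (hγ : ∀ t, γ t ∈ 𝒮) (j : Fin m) :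
    DualPath (h j) (A.ℓ j) σ η (1 - αD) (fbar / ρ j) (muMax fbar bbar σ A.β η (ρ j)) (bbar + ρ j)
      ((bbar + ρ j) / (1 - A.β)) A.T
      (fun t => (trajectory A sel γ t).μ j)
      (fun t => ρ j - spent A sel γ t j)
      (fun t => αD * (trajectory A sel γ t).err t j
        - αI * A.β * integralTerm A sel γ t j) := by
  have hβ : 0 < 1 - A.β := by linarith
  have hG : 0 < bbar + ρ j := by linarith [hρ j]
  have hg : ∀ t < A.T, |ρ j - spent A sel γ t j| ≤ bbar + ρ j := by
    intro t ht
    have h1 := spent_nonneg hreg hsel hγ hμ ht j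
    have h2 := spent_le hreg hsel hγ hμ ht j
    simp only [Pi.zero_apply] at h1
    rw [abs_le]
    constructor <;> linarith [hρ j]
  have herr : ∀ t ≤ A.T, |(trajectory A sel γ t).err t j| ≤ bbar + ρ j := by
    intro t ht
    cases t with
    | zero =>
      rw [trajectory_err_zero A sel γ 0 ht]
      simpa using hG.le
    | succ t =>
      rw [trajectory_succ_err A sel γ ht, Function.update_self, hBT]
      exact hg t ht
  have hJ : ∀ t ≤ A.T, |integralTerm A sel γ t j| ≤ (bbar + ρ j) / (1 - A.β) := by
    intro t
    induction t with
    | zero =>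
      intro _
      simp only [integralTerm, Finset.range_zero, Finset.sum_empty, abs_zero]
      positivity
    | succ t ih =>
      intro ht
      rw [integralTerm_succ A sel γ ht, hBT]
      have h1 := abs_add_le (ρ j - spent A sel γ t j) (A.β * integralTerm A sel γ t j)
      have h2 : |A.β * integralTerm A sel γ t j| ≤ A.β * ((bbar + ρ j) / (1 - A.β)) := by
        rw [abs_mul, abs_of_nonneg hβ0]
        exact mul_le_mul_of_nonneg_left (ih (by omega)) hβ0
      -- The bound is the fixed point of `x ↦ G + β x` with `G = bbar + ρ j`.
      have h3 : bbar + ρ j + A.β * ((bbar + ρ j) / (1 - A.β)) = (bbar + ρ j) / (1 - A.β) := by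
        field_simp
        ring
      linarith [hg t ht]
  refine
    { strictMonoOn := hmono j
      continuousOn := hcont j
      isReference := href j
      strongConvexOn := hsc j
      sigma_pos := hσ
      eta_pos := hη
      kappa_nonneg := by linarith
      kappa_le_one := by linarith
      F_nonneg := div_nonneg hfbar (hρ j).le
      G_pos := hG
      W_nonneg := by positivity
      margin := ?_
      init_nonneg := hμ j
      init_le := hμ1 j
      init_deriv := ?_
      step := ?_
      g_abs := hg
      w_zero := ?_
      w_abs := ?_
      g_nonneg := ?_ }
  -- `muMax` leaves room `4 η W / σ` above `fbar / ρ j`; since `G ≤ W`, already `3 η W / σ` would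
  -- do.
  · have h1 : bbar + ρ j ≤ (bbar + ρ j) / (1 - A.β) := by
      rw [le_div_iff₀ hβ]
      nlinarith
    have h2 : σ * (muMax fbar bbar σ A.β η (ρ j) - fbar / ρ j)
        = 4 * (η * ((bbar + ρ j) / (1 - A.β))) := by
      rw [muMax]
      field_simp
      ring
    rw [h2]
    have h3 := mul_le_mul_of_nonneg_left h1 hη.le
    have h4 : 0 ≤ η * ((bbar + ρ j) / (1 - A.β)) := by positivity
    linarith
  · change HasDerivWithinAt (h j) (A.ℓ j (A.μ₁ j)) (Ici 0) (A.μ₁ j)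
    rcases (hμ j).eq_or_lt with h0 | h0
    · rw [← h0]
      exact hμd j h0.symm
    · exact (href j).hasDerivWithinAt h0
  · intro t ht
    have h1 := trajectory_succ_μ A sel γ ht j
    rw [hBT, integralTerm_succ A sel γ ht, hBT] at h1
    rw [h1, trajectory_succ_err A sel γ ht, Function.update_self, integralTerm_succ A sel γ ht,
      hBT]
    -- Substituting `β J t = J (t+1) - g t` into `w` turns `(1 - αD) g t + w (t+1) - w t` into the
    -- three PID terms divided by `η`.
    rw [hKP, hKI, hKD]
    congr 2
    ring
  · rw [trajectory_err_zero A sel γ 0 (Nat.zero_le _)]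
    simp [integralTerm]
  · intro t ht
    have h1 := abs_sub (αD * (trajectory A sel γ t).err t j) (αI * A.β * integralTerm A sel γ t j)
    rw [abs_mul, abs_mul, abs_of_nonneg hαD, abs_of_nonneg (mul_nonneg hαI hβ0)] at h1
    have h2 := mul_le_mul_of_nonneg_left (herr t ht) hαD
    have h3 := mul_le_mul_of_nonneg_left (hJ t ht) (mul_nonneg hαI hβ0)
    refine h1.trans ((add_le_add h2 h3).trans ?_)
    rw [mul_div_assoc', ← sub_nonneg]
    have : (bbar + ρ j) / (1 - A.β) - (αD * (bbar + ρ j) + αI * A.β * (bbar + ρ j) / (1 - A.β))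
        = (bbar + ρ j) * ((1 - αD - αI * A.β) + αD * A.β) / (1 - A.β) := by
      field_simp
      ring
    rw [this]
    have h4 : 0 ≤ (1 - αD - αI * A.β) + αD * A.β := by nlinarith [mul_nonneg hαD hβ0]
    positivity
  · intro t ht hF
    rw [spent_eq A sel γ ht]
    exact sub_nonneg.2 (consumption_action_le hreg hsel (hγ _)
      (trajectory_μ_nonneg A sel γ hμ t (le_of_lt ht)) (hρ j) hF)

end Path

/-! ### Complementary slackness along a path -/

/-- A predicate on times that is lost forever once it fails holds on an initial segment. -/
theorem exists_initial_segment (T : ℕ) (p : ℕ → Prop)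
    (hp : ∀ s t, s ≤ t → t ≤ T → p t → p s) :
    ∃ τ ≤ T, (∀ t < T, p t ↔ t < τ) ∧ (τ < T → ¬ p τ) := by
  classical
  by_cases h : ∃ t, t < T ∧ ¬ p t
  · obtain ⟨h1, h2⟩ := Nat.find_spec h
    refine ⟨Nat.find h, h1.le, fun t ht => ⟨fun hpt => ?_, fun hlt => ?_⟩, fun _ => h2⟩
    · by_contra hle
      exact h2 (hp _ t (not_lt.1 hle) ht.le hpt)
    · by_contra hpt
      exact Nat.find_min h hlt ⟨ht, hpt⟩
  · push Not at h
    exact ⟨T, le_rfl, fun t ht => ⟨fun _ => ht, fun _ => h t ht⟩, fun h => absurd h (lt_irrefl _)⟩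

/-- No resource can be exhausted by the request with index `t`. -/
def HasSlack (A : PIDInput m) (sel : Request d m → (Fin m → ℝ) → Fin d → ℝ) (bbar : ℝ)
    (γ : Fin A.T → Request d m) (t : ℕ) : Prop :=
  ∀ j, bbar ≤ (trajectory A sel γ t).budget j

section Pathwise

variable {A : PIDInput m} {sel : Request d m → (Fin m → ℝ) → Fin d → ℝ}
  {γ : Fin A.T → Request d m} {𝒮 : Set (Request d m)} {fbar bbar : ℝ}

open Classical in
/-- The complementary slackness term is controlled by the regret of the dual variables against
`0`, or against `fbar / ρ` for a depleted resource. -/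
theorem sum_slackness_le (hfbar : 0 ≤ fbar) (hbbar : 0 ≤ bbar) {ρ : Fin m → ℝ} (hρ : ∀ j, 0 < ρ j)
    (hB : ∀ j, A.B j = ρ j * A.T)
    (hreg : ∀ γ ∈ 𝒮, γ.IsRegular fbar bbar) (hsel : IsSelection 𝒮 sel)
    (hγ : ∀ t, γ t ∈ 𝒮) (hμ : 0 ≤ A.μ₁) {D : Fin m → ℝ}
    (hD : ∀ j, ∀ n ≤ A.T, ∀ u, u = 0 ∨ u = fbar / ρ j → ∑ t ∈ Finset.range n,
      (ρ j - spent A sel γ t j) * ((trajectory A sel γ t).μ j - u) ≤ D j) :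
    ∑ t ∈ Finset.range A.T, (if HasSlack A sel bbar γ t then
        ∑ j, (trajectory A sel γ t).μ j * (ρ j - spent A sel γ t j) else fbar)
      ≤ ∑ j, (D j + bbar * (fbar / ρ j)) := by
  obtain ⟨τ, hτ, hiff, hend⟩ := exists_initial_segment A.T (HasSlack A sel bbar γ)
    fun s t hst ht h j => (h j).trans (trajectory_budget_anti hreg hsel hγ hμ hst ht j)
  have hsum : ∑ t ∈ Finset.range A.T, (if HasSlack A sel bbar γ t then
        ∑ j, (trajectory A sel γ t).μ j * (ρ j - spent A sel γ t j) else fbar)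
      = ∑ j, ∑ t ∈ Finset.range τ, (ρ j - spent A sel γ t j) * (trajectory A sel γ t).μ j
        + (A.T - τ) * fbar := by
    rw [← Finset.sum_range_add_sum_Ico _ hτ, Finset.sum_comm]
    congr 1
    · refine Finset.sum_congr rfl fun t ht => ?_
      have ht' := Finset.mem_range.1 ht
      rw [if_pos ((hiff t (by omega)).2 ht')]
      exact Finset.sum_congr rfl fun j _ => mul_comm _ _
    · rw [Finset.sum_congr rfl (g := fun _ => fbar)]
      · simp [Nat.cast_sub hτ]
      · intro t ht
        have ht' := Finset.mem_Ico.1 ht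
        rw [if_neg]
        rw [hiff t ht'.2]
        omega
  have hbF : ∀ j, 0 ≤ bbar * (fbar / ρ j) := fun j =>
    mul_nonneg hbbar (div_nonneg hfbar (hρ j).le)
  have h0 : ∀ j, ∑ t ∈ Finset.range τ, (ρ j - spent A sel γ t j) * (trajectory A sel γ t).μ j
      ≤ D j := fun j => by simpa using hD j τ hτ 0 (Or.inl rfl)
  rw [hsum]
  rcases hτ.eq_or_lt with rfl | hlt
  · rw [sub_self, zero_mul, add_zero]
    exact Finset.sum_le_sum fun j _ => by linarith [h0 j, hbF j]
  · have hns := hend hlt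
    simp only [HasSlack, not_forall, not_le] at hns
    obtain ⟨k, hk⟩ := hns
    -- At time `τ` less than `bbar` of resource `k` is left out of `ρ k * T`.
    have hspent : ∑ t ∈ Finset.range τ, (ρ k - spent A sel γ t k) ≤ bbar - (A.T - τ) * ρ k := by
      rw [trajectory_budget A sel γ τ hτ] at hk
      simp only [Pi.sub_apply, Finset.sum_apply, hB] at hk
      rw [Finset.sum_sub_distrib, Finset.sum_const, Finset.card_range, nsmul_eq_mul]
      linarith
    have hk' : ∑ t ∈ Finset.range τ, (ρ k - spent A sel γ t k) * (trajectory A sel γ t).μ k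
        ≤ D k + bbar * (fbar / ρ k) - (A.T - τ) * fbar := by
      -- The comparator `fbar / ρ k` converts the overspending into `-(T - τ) * fbar`, exactly the
      -- charge for the rounds from `τ` on.
      have h1 := hD k τ hτ _ (Or.inr rfl)
      have h2 : ∑ t ∈ Finset.range τ, (ρ k - spent A sel γ t k) * (trajectory A sel γ t).μ k
          = ∑ t ∈ Finset.range τ,
              (ρ k - spent A sel γ t k) * ((trajectory A sel γ t).μ k - fbar / ρ k)
            + (∑ t ∈ Finset.range τ, (ρ k - spent A sel γ t k)) * (fbar / ρ k) := by
        rw [Finset.sum_mul, ← Finset.sum_add_distrib]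
        exact Finset.sum_congr rfl fun t _ => by ring
      have h3 := mul_le_mul_of_nonneg_right hspent (div_nonneg hfbar (hρ k).le)
      have h4 : (bbar - (A.T - τ) * ρ k) * (fbar / ρ k)
          = bbar * (fbar / ρ k) - (A.T - τ) * fbar := by
        rw [sub_mul, mul_assoc, mul_div_cancel₀ _ (hρ k).ne']
      linarith
    have h5 : ∀ j, ∑ t ∈ Finset.range τ, (ρ j - spent A sel γ t j) * (trajectory A sel γ t).μ j
        ≤ (D j + bbar * (fbar / ρ j)) - (if j = k then (A.T - τ) * fbar else 0) := by
      intro j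
      split_ifs with hj
      · rw [hj]
        exact hk'
      · linarith [h0 j, hbF j]
    have h6 := Finset.sum_le_sum fun j (_ : j ∈ Finset.univ) => h5 j
    rw [Finset.sum_sub_distrib, Finset.sum_ite_eq', if_pos (Finset.mem_univ _)] at h6
    linarith

/-- Adaptedness of the controller, which replaces the use of a filtration. -/
theorem trajectory_congr {γ' : Fin A.T → Request d m} :
    ∀ {t : ℕ}, (∀ i : Fin A.T, i.val < t → γ i = γ' i) →
      trajectory A sel γ t = trajectory A sel γ' t := by
  intro t
  induction t with
  | zero => intro _; rfl
  | succ t ih =>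
    intro h
    rw [trajectory, trajectory, ih fun i hi => h i (by omega)]
    split_ifs with ht
    · rw [h ⟨t, ht⟩ (Nat.lt_succ_self t)]
    · rfl

end Pathwise

/-! ### Offline optimum and weak duality -/

section Offline

variable {fbar bbar : ℝ} {T : ℕ} {B : Fin m → ℝ} {γ : Fin T → Request d m}

theorem offlineOpt_le_of_forall (hB : 0 ≤ B) (hreg : ∀ t, (γ t).IsRegular fbar bbar) {c : ℝ}
    (hc : ∀ x : Fin T → Fin d → ℝ, (∀ t, x t ∈ (γ t).feasible) →
      ∑ t, (γ t).consumption (x t) ≤ B → ∑ t, (γ t).reward (x t) ≤ c) :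
    offlineOpt B γ ≤ c := by
  -- The zero actions are feasible, so the supremum is over a nonempty set.
  refine csSup_le ⟨_, 0, fun t => (hreg t).zero_mem, ?_, rfl⟩ ?_
  · exact (Finset.sum_eq_zero fun t _ => (hreg t).consumption_zero).trans_le hB
  · rintro _ ⟨x, hx, hxB, rfl⟩
    exact hc x hx hxB

theorem sum_reward_le (hreg : ∀ t, (γ t).IsRegular fbar bbar) {x : Fin T → Fin d → ℝ}
    (hx : ∀ t, x t ∈ (γ t).feasible) : ∑ t, (γ t).reward (x t) ≤ T * fbar := by
  have := Finset.sum_le_sum fun t (_ : t ∈ Finset.univ) => (hreg t).reward_le _ (hx t)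
  simpa using this

theorem offlineOpt_le (hB : 0 ≤ B) (hreg : ∀ t, (γ t).IsRegular fbar bbar) :
    offlineOpt B γ ≤ T * fbar :=
  offlineOpt_le_of_forall hB hreg fun _ hx _ => sum_reward_le hreg hx

theorem offlineOpt_nonneg (hreg : ∀ t, (γ t).IsRegular fbar bbar) : 0 ≤ offlineOpt B γ := by
  refine Real.sSup_nonneg ?_
  rintro _ ⟨x, hx, -, rfl⟩
  exact Finset.sum_nonneg fun t _ => (hreg t).reward_nonneg _ (hx t)

/-- Weak duality. -/
theorem offlineOpt_le_dual (hB : 0 ≤ B) (hreg : ∀ t, (γ t).IsRegular fbar bbar)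
    {μ : Fin m → ℝ} (hμ : 0 ≤ μ) {y : Fin T → Fin d → ℝ}
    (hy : ∀ t, IsMaxOn ((γ t).adjusted μ) (γ t).feasible (y t)) :
    offlineOpt B γ ≤ ∑ t, (γ t).adjusted μ (y t) + ∑ j, μ j * B j := by
  refine offlineOpt_le_of_forall hB hreg fun x hx hxB => ?_
  have h1 : ∑ t, (γ t).reward (x t)
      = ∑ t, (γ t).adjusted μ (x t) + ∑ j, μ j * (∑ t, (γ t).consumption (x t)) j := by
    simp only [Request.adjusted, Finset.sum_sub_distrib, Finset.sum_apply, Finset.mul_sum]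
    rw [Finset.sum_comm (s := Finset.univ (α := Fin m))]
    ring
  rw [h1]
  exact add_le_add (Finset.sum_le_sum fun t _ => hy t (hx t))
    (Finset.sum_le_sum fun j _ => mul_le_mul_of_nonneg_left (hxB j) (hμ j))

end Offline

/-! ### Measurability of the controller -/

section Measurability

/-- `responseInv ℓ` is monotone only until its defining set becomes empty, where it falls back to
`0`. Its superlevel sets are still order-connected, hence measurable. -/
theorem measurable_responseInv (ℓ : ℝ → ℝ) : Measurable (responseInv ℓ) := by
  refine measurable_of_Ici fun a => ?_
  refine OrdConnected.measurableSet ⟨fun x hx y hy z hz => ?_⟩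
  have hnonneg : ∀ y, 0 ≤ responseInv ℓ y := fun y => Real.sInf_nonneg fun s hs => hs.1.le
  simp only [mem_preimage, mem_Ici] at hx hy ⊢
  rcases le_or_gt a 0 with ha | ha
  · exact ha.trans (hnonneg z)
  · have hne : {s | 0 < s ∧ y ≤ ℓ s}.Nonempty := by
      by_contra hemp
      rw [not_nonempty_iff_eq_empty] at hemp
      rw [responseInv, hemp, Real.sInf_empty] at hy
      linarith
    refine hx.trans (csInf_le_csInf ⟨0, fun s hs => hs.1.le⟩ ?_ fun s hs => ?_)
    · exact hne.mono fun s hs => ⟨hs.1, hz.2.trans hs.2⟩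
    · exact ⟨hs.1, hz.1.trans hs.2⟩

/-- Nothing is known about `ℓ` on negative numbers, so it is replaced there by the constant `ℓ 0`,
which a nonnegative `f` cannot detect. -/
theorem measurable_comp_of_continuousOn_Ioi {Ω : Type*} [MeasurableSpace Ω] {ℓ : ℝ → ℝ}
    (hℓ : ContinuousOn ℓ (Ioi 0)) {f : Ω → ℝ} (hf : Measurable f) (h0 : ∀ ω, 0 ≤ f ω) :
    Measurable fun ω => ℓ (f ω) := by
  classical
  have h1 : Measurable ((Ioi (0 : ℝ)).piecewise ℓ fun _ => ℓ 0) :=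
    hℓ.measurable_piecewise continuousOn_const measurableSet_Ioi
  convert h1.comp hf using 1
  ext ω
  rcases (h0 ω).eq_or_lt with h | h
  · simp [← h]
  · simp [Set.piecewise, h]

variable {A : PIDInput m} {sel : Request d m → (Fin m → ℝ) → Fin d → ℝ}
  {𝒮 : Set (Request d m)} [MeasurableSpace 𝒮] {fbar bbar : ℝ}

/-- Applied with `F` the consumption and with `F` the reward of the action taken. -/
theorem measurable_ite_fits
    (hb : Measurable (fun p : 𝒮 × (Fin m → ℝ) => p.1.1.consumption (sel p.1.1 p.2)))
    {β : Type*} [MeasurableSpace β] {t : Fin A.T}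
    (h1 : Measurable fun ω : Fin A.T → 𝒮 => (trajectory A sel (fun i => (ω i).1) t).μ)
    (h2 : Measurable fun ω : Fin A.T → 𝒮 => (trajectory A sel (fun i => (ω i).1) t).budget)
    {F : Request d m → (Fin d → ℝ) → β}
    (hF : Measurable (fun p : 𝒮 × (Fin m → ℝ) => F p.1.1 (sel p.1.1 p.2)))
    (hF0 : Measurable fun r : 𝒮 => F r.1 0) :
    Measurable fun ω : Fin A.T → 𝒮 =>
      F (ω t).1 (action sel (ω t).1 (trajectory A sel (fun i => (ω i).1) t)) := by
  classical
  have hp : Measurable fun ω : Fin A.T → 𝒮 =>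
      (ω t, (trajectory A sel (fun i => (ω i).1) t).μ) := (measurable_pi_apply t).prodMk h1
  have hset : MeasurableSet {ω : Fin A.T → 𝒮 |
      (ω t).1.consumption (sel (ω t).1 (trajectory A sel (fun i => (ω i).1) t).μ)
        ≤ (trajectory A sel (fun i => (ω i).1) t).budget} :=
    measurableSet_le (hb.comp hp) h2
  have hite := @Measurable.ite _ _ _ _ _ _ _ (Classical.decPred _) hset (hF.comp hp)
    (hF0.comp (measurable_pi_apply t))
  convert hite using 2 with ω
  rw [action]
  split_ifs <;> rfl

variable (hreg : ∀ γ ∈ 𝒮, γ.IsRegular fbar bbar)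
  (hb : Measurable (fun p : 𝒮 × (Fin m → ℝ) => p.1.1.consumption (sel p.1.1 p.2)))
include hreg hb

theorem measurable_spent {t : ℕ} (ht : t < A.T)
    (h1 : Measurable fun ω : Fin A.T → 𝒮 => (trajectory A sel (fun i => (ω i).1) t).μ)
    (h2 : Measurable fun ω : Fin A.T → 𝒮 => (trajectory A sel (fun i => (ω i).1) t).budget) :
    Measurable fun ω : Fin A.T → 𝒮 => spent A sel (fun i => (ω i).1) t := by
  simp only [spent_eq A sel _ ht]
  refine measurable_ite_fits (t := ⟨t, ht⟩) hb h1 h2 (F := fun r x => r.consumption x) hb ?_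
  simp only [fun r : 𝒮 => (hreg r.1 r.2).consumption_zero]
  exact measurable_const

theorem measurable_trajectory (hcont : ∀ j, ContinuousOn (A.ℓ j) (Ioi 0)) (hμ : 0 ≤ A.μ₁) :
    ∀ t ≤ A.T,
      Measurable (fun ω : Fin A.T → 𝒮 => (trajectory A sel (fun i => (ω i).1) t).μ) ∧
      Measurable (fun ω : Fin A.T → 𝒮 => (trajectory A sel (fun i => (ω i).1) t).budget) ∧
      ∀ k, Measurable (fun ω : Fin A.T → 𝒮 => (trajectory A sel (fun i => (ω i).1) t).err k) := by
  intro t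
  induction t with
  | zero => exact fun _ => ⟨measurable_const, measurable_const, fun _ => measurable_const⟩
  | succ t ih =>
    intro ht
    obtain ⟨h1, h2, h3⟩ := ih (by omega)
    have hs := measurable_spent hreg hb ht h1 h2
    have hg : Measurable fun ω : Fin A.T → 𝒮 =>
        fun j => A.B j / A.T - spent A sel (fun i => (ω i).1) t j :=
      measurable_pi_lambda _ fun j => measurable_const.sub ((measurable_pi_apply j).comp hs)
    have herr : ∀ k, Measurable
        (fun ω : Fin A.T → 𝒮 => (trajectory A sel (fun i => (ω i).1) (t + 1)).err k) := by
      intro k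
      simp only [trajectory_succ_err A sel _ ht]
      by_cases hk : k = t + 1
      · subst hk
        simpa only [Function.update_self] using hg
      · simpa only [Function.update_of_ne hk] using h3 k
    refine ⟨measurable_pi_lambda _ fun j => ?_, ?_, herr⟩
    · simp only [trajectory_succ_μ A sel _ ht]
      refine ((measurable_responseInv _).comp ?_).max measurable_const
      have hℓ := measurable_comp_of_continuousOn_Ioi (hcont j) ((measurable_pi_apply j).comp h1)
        fun ω => trajectory_μ_nonneg A sel (fun i => (ω i).1) hμ t (le_of_lt ht) j
      have hgj := (measurable_pi_apply j).comp hg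
      have hint : Measurable fun ω : Fin A.T → 𝒮 =>
          integralTerm A sel (fun i => (ω i).1) (t + 1) j :=
        Finset.measurable_sum _ fun i _ =>
          ((measurable_pi_apply j).comp (herr (t + 1 - i))).const_mul _
      exact ((hℓ.sub (hgj.const_mul _)).sub (hint.const_mul _)).sub
        ((hgj.sub ((measurable_pi_apply j).comp (h3 t))).const_mul _)
    · simp only [trajectory_succ_budget A sel _ ht]
      exact h2.sub hs

end Measurability

/-! ### Independence by resampling one coordinate -/

section Resampling

variable {ι α : Type*} [Fintype ι] [DecidableEq ι] [MeasurableSpace α] (P : Measure α)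
  [IsProbabilityMeasure P]

omit [Fintype ι] in
theorem measurable_update_prod (i : ι) :
    Measurable fun p : (ι → α) × α => Function.update p.1 i p.2 := by
  refine measurable_pi_lambda _ fun k => ?_
  by_cases hk : k = i
  · subst hk
    simpa using measurable_snd
  · simp only [Function.update_of_ne hk]
    exact (measurable_pi_apply k).comp measurable_fst

/-- Resampling one coordinate preserves a product of copies of a probability measure. -/
theorem measurePreserving_update (i : ι) :
    MeasurePreserving (fun p : (ι → α) × α => Function.update p.1 i p.2)
      ((Measure.pi fun _ => P).prod P) (Measure.pi fun _ => P) := by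
  refine ⟨measurable_update_prod i, (Measure.pi_eq fun s hs => ?_).symm⟩
  rw [Measure.map_apply (measurable_update_prod i) (MeasurableSet.univ_pi hs)]
  -- On a box, the `i`-th constraint moves to the fresh sample and the old `i`-th coordinate becomes
  -- free, contributing a factor `1`.
  have : (fun p : (ι → α) × α => Function.update p.1 i p.2) ⁻¹' univ.pi s
      = (univ.pi (Function.update s i univ)) ×ˢ s i := by
    ext p
    simp only [mem_preimage, Set.mem_pi, mem_univ, true_implies, mem_prod]
    constructor
    · intro h
      refine ⟨fun k => ?_, by simpa using h i⟩
      by_cases hk : k = i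
      · subst hk
        simp
      · simpa [hk] using h k
    · rintro ⟨h1, h2⟩ k
      by_cases hk : k = i
      · subst hk
        simpa using h2
      · simpa [hk] using h1 k
  rw [this, Measure.prod_prod, Measure.pi_pi, ← Finset.prod_erase_mul _ _ (Finset.mem_univ i),
    ← Finset.prod_erase_mul (a := i) Finset.univ (fun k => P (s k)) (Finset.mem_univ i)]
  simp only [Function.update_self, measure_univ, mul_one]
  congr 1
  refine Finset.prod_congr rfl fun k hk => ?_
  rw [Function.update_of_ne (Finset.ne_of_mem_erase hk)]

/-- Fubini after resampling; the inner integral plays the role of the conditional expectation given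
the other coordinates. -/
theorem le_integral_pi_of_forall_update (i : ι) {Z : (ι → α) → ℝ} (hZ : Measurable Z) {C k : ℝ}
    (hC : ∀ ω, |Z ω| ≤ C) (hk : ∀ ω, k ≤ ∫ x, Z (Function.update ω i x) ∂P) :
    k ≤ ∫ ω, Z ω ∂(Measure.pi fun _ => P) := by
  have hm := measurePreserving_update P i
  have hZ' : Measurable fun p : (ι → α) × α => Z (Function.update p.1 i p.2) :=
    hZ.comp (measurable_update_prod i)
  have hint : Integrable (fun p : (ι → α) × α => Z (Function.update p.1 i p.2))
      ((Measure.pi fun _ => P).prod P) :=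
    Integrable.of_bound hZ'.aestronglyMeasurable C (ae_of_all _ fun p => hC _)
  rw [← hm.map_eq, integral_map hm.measurable.aemeasurable hZ.aestronglyMeasurable,
    integral_prod _ hint]
  calc k = ∫ _, k ∂(Measure.pi fun _ : ι => P) := by simp
    _ ≤ _ := integral_mono (integrable_const _) hint.integral_prod_left hk

end Resampling

/-! ### From pathwise bounds to the expected gap -/

section Expectation

variable {A : PIDInput m} {sel : Request d m → (Fin m → ℝ) → Fin d → ℝ}
  {𝒮 : Set (Request d m)} [MeasurableSpace 𝒮] {fbar bbar : ℝ}
  (hreg : ∀ γ ∈ 𝒮, γ.IsRegular fbar bbar) (hsel : IsSelection 𝒮 sel)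
  (hr : Measurable (fun p : 𝒮 × (Fin m → ℝ) => p.1.1.reward (sel p.1.1 p.2)))
  (hb : Measurable (fun p : 𝒮 × (Fin m → ℝ) => p.1.1.consumption (sel p.1.1 p.2)))

include hr hb in
theorem measurable_adjusted : Measurable
    fun p : 𝒮 × (Fin m → ℝ) => p.1.1.adjusted p.2 (sel p.1.1 p.2) :=
  hr.sub (Finset.measurable_sum _ fun j _ =>
    ((measurable_pi_apply j).comp measurable_snd).mul ((measurable_pi_apply j).comp hb))

theorem totalReward_eq (γ : Fin A.T → Request d m) :
    totalReward A sel γ = ∑ t : Fin A.T, (γ t).reward (action sel (γ t) (trajectory A sel γ t)) := by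
  simp only [totalReward, state_eq_trajectory, Fin.val_castSucc]

omit [MeasurableSpace 𝒮] in
include hreg hsel in
theorem abs_totalReward_le {γ : Fin A.T → Request d m} (hγ : ∀ t, γ t ∈ 𝒮) (hμ : 0 ≤ A.μ₁) :
    |totalReward A sel γ| ≤ A.T * fbar := by
  have hx : ∀ t : Fin A.T, action sel (γ t) (trajectory A sel γ t) ∈ (γ t).feasible := fun t =>
    action_mem_feasible hreg hsel (hγ t) (trajectory_μ_nonneg A sel γ hμ t t.2.le)
  rw [totalReward_eq, abs_of_nonneg
    (Finset.sum_nonneg fun t _ => (hreg _ (hγ t)).reward_nonneg _ (hx t))]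
  exact sum_reward_le (fun t => hreg _ (hγ t)) hx

include hreg hr hb in
theorem measurable_totalReward (hr0 : Measurable (fun γ : 𝒮 => γ.1.reward 0))
    (hcont : ∀ j, ContinuousOn (A.ℓ j) (Ioi 0)) (hμ : 0 ≤ A.μ₁) :
    Measurable fun ω : Fin A.T → 𝒮 => totalReward A sel fun i => (ω i).1 := by
  simp only [totalReward_eq]
  refine Finset.measurable_sum _ fun t _ => ?_
  obtain ⟨h1, h2, -⟩ := measurable_trajectory hreg hb hcont hμ t t.2.le
  exact measurable_ite_fits hb h1 h2 (F := fun r x => r.reward x) hr hr0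

include hreg hsel hr hb in
/-- The expected offline optimum per period is a lower bound for the dual function. -/
theorem integral_offlineOpt_le_dual (hB : 0 ≤ A.B) (hT : 0 < A.T) (P : ProbabilityMeasure 𝒮)
    (hopt : AEMeasurable (fun ω : Fin A.T → 𝒮 => offlineOpt A.B fun t => (ω t).1)
      (Measure.pi fun _ => (P : Measure 𝒮))) {μ : Fin m → ℝ} (hμ : 0 ≤ μ) :
    (∫ ω : Fin A.T → 𝒮, offlineOpt A.B (fun t => (ω t).1) ∂(Measure.pi fun _ => (P : Measure 𝒮)))
      / A.T ≤ ∫ r : 𝒮, r.1.adjusted μ (sel r.1 μ) + ∑ j, A.B j / A.T * μ j ∂(P : Measure 𝒮) := by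
  have hreg' : ∀ (ω : Fin A.T → 𝒮) t, ((ω t).1).IsRegular fbar bbar :=
    fun ω t => hreg _ (ω t).2
  have hT' : (0 : ℝ) < A.T := by exact_mod_cast hT
  have hφ : Measurable fun r : 𝒮 => r.1.adjusted μ (sel r.1 μ) :=
    (measurable_adjusted hr hb).comp (measurable_id.prodMk measurable_const)
  have hφb : ∀ r : 𝒮, |r.1.adjusted μ (sel r.1 μ)| ≤ fbar := fun r => by
    rw [abs_of_nonneg (adjusted_nonneg hreg hsel r.2 hμ)]
    exact adjusted_le hreg hsel r.2 hμ
  have hφi : Integrable (fun r : 𝒮 => r.1.adjusted μ (sel r.1 μ)) (P : Measure 𝒮) :=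
    Integrable.of_bound hφ.aestronglyMeasurable fbar (ae_of_all _ hφb)
  have hmp : ∀ t : Fin A.T, MeasurePreserving (fun ω : Fin A.T → 𝒮 => ω t)
      (Measure.pi fun _ => (P : Measure 𝒮)) (P : Measure 𝒮) := fun t =>
    measurePreserving_eval (fun _ => (P : Measure 𝒮)) t
  have hφt : ∀ t : Fin A.T, Integrable (fun ω : Fin A.T → 𝒮 =>
      (ω t).1.adjusted μ (sel (ω t).1 μ)) (Measure.pi fun _ => (P : Measure 𝒮)) := fun t =>
    (hmp t).integrable_comp_of_integrable hφi
  have hopti : Integrable (fun ω : Fin A.T → 𝒮 => offlineOpt A.B fun t => (ω t).1)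
      (Measure.pi fun _ => (P : Measure 𝒮)) :=
    Integrable.of_bound hopt.aestronglyMeasurable (A.T * fbar) (ae_of_all _ fun ω => by
      rw [Real.norm_eq_abs, abs_of_nonneg (offlineOpt_nonneg (hreg' ω))]
      exact offlineOpt_le hB (hreg' ω))
  -- Weak duality holds for every sample with the same `μ`; each of the `T` summands then has the
  -- same mean, because every coordinate has law `P`.
  have hle : ∫ ω : Fin A.T → 𝒮, offlineOpt A.B (fun t => (ω t).1)
        ∂(Measure.pi fun _ => (P : Measure 𝒮))
      ≤ ∫ ω : Fin A.T → 𝒮, (∑ t, (ω t).1.adjusted μ (sel (ω t).1 μ) + ∑ j, μ j * A.B j)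
        ∂(Measure.pi fun _ => (P : Measure 𝒮)) :=
    integral_mono hopti ((integrable_finsetSum _ fun t _ => hφt t).add (integrable_const _))
      fun ω => offlineOpt_le_dual hB (hreg' ω) hμ fun t => (hsel _ (ω t).2 μ hμ).2
  have heval : ∀ t : Fin A.T, ∫ ω : Fin A.T → 𝒮, (ω t).1.adjusted μ (sel (ω t).1 μ)
        ∂(Measure.pi fun _ => (P : Measure 𝒮))
      = ∫ r : 𝒮, r.1.adjusted μ (sel r.1 μ) ∂(P : Measure 𝒮) := fun t => by
    conv_rhs => rw [← (hmp t).map_eq]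
    rw [integral_map (hmp t).measurable.aemeasurable hφ.aestronglyMeasurable]
  rw [integral_add (integrable_finsetSum _ fun t _ => hφt t) (integrable_const _),
    integral_finsetSum _ fun t _ => hφt t, Finset.sum_congr rfl fun t _ => heval t] at hle
  rw [integral_add hφi (integrable_const _), div_le_iff₀ hT']
  simp only [Finset.sum_const, Finset.card_univ, Fintype.card_fin, nsmul_eq_mul, integral_const,
    probReal_univ, one_smul] at hle ⊢
  refine hle.trans (le_of_eq ?_)
  rw [add_mul, Finset.sum_mul, mul_comm]
  congr 1
  refine Finset.sum_congr rfl fun j _ => ?_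
  field_simp

open Classical in
omit [MeasurableSpace 𝒮] in
include hreg hsel in
/-- While there is slack, the reward is the adjusted reward plus the value of the resources
consumed. -/
theorem le_totalReward {γ : Fin A.T → Request d m} (hγ : ∀ t, γ t ∈ 𝒮) (hμ : 0 ≤ A.μ₁) {k : ℝ}
    (hk : k ≤ fbar) :
    ∑ t : Fin A.T, (if HasSlack A sel bbar γ t then
        (γ t).adjusted (trajectory A sel γ t).μ (sel (γ t) (trajectory A sel γ t).μ)
          + ∑ j, A.B j / A.T * (trajectory A sel γ t).μ j else k)
      - ∑ t ∈ Finset.range A.T, (if HasSlack A sel bbar γ t then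
        ∑ j, (trajectory A sel γ t).μ j * (A.B j / A.T - spent A sel γ t j) else fbar)
      ≤ totalReward A sel γ := by
  rw [totalReward_eq, Finset.sum_range, ← Finset.sum_sub_distrib]
  refine Finset.sum_le_sum fun t _ => ?_
  have hμt := trajectory_μ_nonneg A sel γ hμ t t.2.le
  have hregt := hreg _ (hγ t)
  split_ifs with hs
  · have hfit : (γ t).consumption (sel (γ t) (trajectory A sel γ t).μ)
        ≤ (trajectory A sel γ t).budget := fun j =>
      (hregt.consumption_apply_le (hsel _ (hγ t) _ hμt).1 j).trans (hs j)
    rw [spent_eq A sel γ t.2, action_of_le hfit, Request.adjusted]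
    simp only [mul_sub, Finset.sum_sub_distrib]
    have : ∑ j, A.B j / A.T * (trajectory A sel γ t).μ j
        = ∑ j, (trajectory A sel γ t).μ j * (A.B j / A.T) :=
      Finset.sum_congr rfl fun j _ => mul_comm _ _
    linarith
  -- Without slack the difference is `k - fbar ≤ 0`, while the reward is nonnegative.
  · have := hregt.reward_nonneg _ (action_mem_feasible hreg hsel (hγ t) hμt)
    linarith

open Classical in
include hreg hsel hr hb in
/-- A pathwise bound for the complementary slackness term bounds the expected gap. -/
theorem integrable_gap_and_integral_gap_le
    (hr0 : Measurable (fun γ : 𝒮 => γ.1.reward 0))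
    (hcont : ∀ j, ContinuousOn (A.ℓ j) (Ioi 0)) (hμ : 0 ≤ A.μ₁)
    (hB : 0 ≤ A.B) (hT : 0 < A.T) (P : ProbabilityMeasure 𝒮)
    (hopt : AEMeasurable (fun ω : Fin A.T → 𝒮 => offlineOpt A.B fun t => (ω t).1)
      (Measure.pi fun _ => (P : Measure 𝒮)))
    {M : Fin m → ℝ} (hM : ∀ (ω : Fin A.T → 𝒮) (t : Fin A.T) (j : Fin m),
      (trajectory A sel (fun i => (ω i).1) t).μ j ≤ M j) {R : ℝ}
    (hR : ∀ ω : Fin A.T → 𝒮, ∑ t ∈ Finset.range A.T,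
      (if HasSlack A sel bbar (fun i => (ω i).1) t then
        ∑ j, (trajectory A sel (fun i => (ω i).1) t).μ j
          * (A.B j / A.T - spent A sel (fun i => (ω i).1) t j) else fbar) ≤ R) :
    Integrable (fun ω : Fin A.T → 𝒮 => gap A sel fun t => (ω t).1)
      (Measure.pi fun _ => (P : Measure 𝒮)) ∧
    ∫ ω : Fin A.T → 𝒮, gap A sel (fun t => (ω t).1) ∂(Measure.pi fun _ => (P : Measure 𝒮)) ≤ R := by
  have hreg' : ∀ (ω : Fin A.T → 𝒮) t, ((ω t).1).IsRegular fbar bbar :=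
    fun ω t => hreg _ (ω t).2
  have hT' : (0 : ℝ) < A.T := by exact_mod_cast hT
  have hoptb : ∀ ω : Fin A.T → 𝒮, ‖offlineOpt A.B fun t => (ω t).1‖ ≤ A.T * fbar := fun ω => by
    rw [Real.norm_eq_abs, abs_of_nonneg (offlineOpt_nonneg (hreg' ω))]
    exact offlineOpt_le hB (hreg' ω)
  have hopti : Integrable (fun ω : Fin A.T → 𝒮 => offlineOpt A.B fun t => (ω t).1)
      (Measure.pi fun _ => (P : Measure 𝒮)) :=
    Integrable.of_bound hopt.aestronglyMeasurable (A.T * fbar) (ae_of_all _ hoptb)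
  have htoti : Integrable (fun ω : Fin A.T → 𝒮 => totalReward A sel fun t => (ω t).1)
      (Measure.pi fun _ => (P : Measure 𝒮)) :=
    Integrable.of_bound (measurable_totalReward hreg hr hb hr0 hcont hμ).aestronglyMeasurable
      (A.T * fbar) (ae_of_all _ fun ω => abs_totalReward_le hreg hsel (fun t => (ω t).2) hμ)
  refine ⟨hopti.sub htoti, ?_⟩
  set K := ∫ ω : Fin A.T → 𝒮, offlineOpt A.B (fun t => (ω t).1)
    ∂(Measure.pi fun _ => (P : Measure 𝒮)) with hK
  have hK0 : 0 ≤ K := integral_nonneg fun ω => offlineOpt_nonneg (hreg' ω)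
  have hKle : K / A.T ≤ fbar := by
    rw [div_le_iff₀ hT', mul_comm]
    calc K ≤ ∫ _ : Fin A.T → 𝒮, (A.T * fbar : ℝ) ∂(Measure.pi fun _ => (P : Measure 𝒮)) :=
          integral_mono hopti (integrable_const _) fun ω => offlineOpt_le hB (hreg' ω)
      _ = A.T * fbar := by simp
  have hk0 : 0 ≤ K / A.T := div_nonneg hK0 hT'.le
  -- Rounds without slack receive the value `K / T`, so that every `Z t` has mean at least `K / T`
  -- and no stopping theorem is needed.
  set Z : Fin A.T → (Fin A.T → 𝒮) → ℝ := fun t ω =>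
    if HasSlack A sel bbar (fun i => (ω i).1) t then
      (ω t).1.adjusted (trajectory A sel (fun i => (ω i).1) t).μ
          (sel (ω t).1 (trajectory A sel (fun i => (ω i).1) t).μ)
        + ∑ j, A.B j / A.T * (trajectory A sel (fun i => (ω i).1) t).μ j
      else K / A.T with hZ
  have hZm : ∀ t, Measurable (Z t) := fun t => by
    obtain ⟨h1, h2, -⟩ := measurable_trajectory (A := A) (sel := sel) hreg hb hcont hμ t t.2.le
    refine Measurable.ite ?_ (Measurable.add ?_ ?_) measurable_const
    · simp only [HasSlack, Set.ofPred_forall]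
      exact MeasurableSet.iInter fun j =>
        measurableSet_le measurable_const ((measurable_pi_apply j).comp h2)
    · exact (measurable_adjusted hr hb).comp ((measurable_pi_apply t).prodMk h1)
    · exact Finset.measurable_sum _ fun j _ => ((measurable_pi_apply j).comp h1).const_mul _
  have hM0 : ∀ (ω : Fin A.T → 𝒮) (t : Fin A.T),
      0 ≤ (trajectory A sel (fun i => (ω i).1) t).μ := fun ω t =>
    trajectory_μ_nonneg A sel _ hμ t t.2.le
  have hc : ∀ j, 0 ≤ A.B j / A.T := fun j => div_nonneg (hB j) hT'.le
  have hZb : ∀ t ω, |Z t ω| ≤ fbar + ∑ j, A.B j / A.T * |M j| := by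
    intro t ω
    have h0 : 0 ≤ ∑ j, A.B j / A.T * |M j| :=
      Finset.sum_nonneg fun j _ => mul_nonneg (hc j) (abs_nonneg _)
    simp only [hZ]
    split_ifs
    · have h1 := adjusted_nonneg hreg hsel (ω t).2 (hM0 ω t)
      have h2 := adjusted_le hreg hsel (ω t).2 (hM0 ω t)
      have h3 : 0 ≤ ∑ j, A.B j / A.T * (trajectory A sel (fun i => (ω i).1) t).μ j :=
        Finset.sum_nonneg fun j _ => mul_nonneg (hc j) (hM0 ω t j)
      have h4 : ∑ j, A.B j / A.T * (trajectory A sel (fun i => (ω i).1) t).μ j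
          ≤ ∑ j, A.B j / A.T * |M j| :=
        Finset.sum_le_sum fun j _ =>
          mul_le_mul_of_nonneg_left ((hM ω t j).trans (le_abs_self _)) (hc j)
      rw [abs_of_nonneg (add_nonneg h1 h3)]
      linarith
    · rw [abs_of_nonneg hk0]
      linarith
  have hZi : ∀ t, Integrable (Z t) (Measure.pi fun _ => (P : Measure 𝒮)) := fun t =>
    Integrable.of_bound (hZm t).aestronglyMeasurable _ (ae_of_all _ (hZb t))
  have hZk : ∀ t, K / A.T ≤ ∫ ω, Z t ω ∂(Measure.pi fun _ => (P : Measure 𝒮)) := by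
    intro t
    refine le_integral_pi_of_forall_update (P : Measure 𝒮) t (hZm t) (hZb t) fun ω => ?_
    -- Resampling request `t` leaves the state before it unchanged, so `μ` is frozen in the inner
    -- integral and weak duality applies.
    have htr : ∀ x, trajectory A sel (fun i => (Function.update ω t x i).1) t
        = trajectory A sel (fun i => (ω i).1) t := fun x =>
      trajectory_congr fun i hi => by
        rw [Function.update_of_ne (fun h => by simp [h] at hi)]
    simp only [hZ, HasSlack, htr, Function.update_self]
    split_ifs
    · exact integral_offlineOpt_le_dual hreg hsel hr hb hB hT P hopt (hM0 ω t)
    · simp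
  have hsum : K ≤ ∫ ω, ∑ t, Z t ω ∂(Measure.pi fun _ => (P : Measure 𝒮)) := by
    rw [integral_finsetSum _ fun t _ => hZi t]
    have := Finset.sum_le_sum fun t (_ : t ∈ Finset.univ) => hZk t
    rw [Finset.sum_const, Finset.card_univ, Fintype.card_fin, nsmul_eq_mul,
      mul_div_cancel₀ _ hT'.ne'] at this
    exact this
  have hfin : ∫ ω, (∑ t, Z t ω - R) ∂(Measure.pi fun _ => (P : Measure 𝒮))
      ≤ ∫ ω : Fin A.T → 𝒮, totalReward A sel (fun t => (ω t).1)
        ∂(Measure.pi fun _ => (P : Measure 𝒮)) :=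
    integral_mono ((integrable_finsetSum _ fun t _ => hZi t).sub (integrable_const _)) htoti
      fun ω => (sub_le_sub_left (hR ω) _).trans
        (le_totalReward hreg hsel (fun t => (ω t).2) hμ hKle)
  rw [integral_sub (integrable_finsetSum _ fun t _ => hZi t) (integrable_const _)] at hfin
  simp only [integral_const, probReal_univ, one_smul] at hfin
  simp only [gap]
  rw [integral_sub hopti htoti]
  linarith

end Expectation

/-! ### Constants independent of the horizon -/

/-- An upper bound for `muMax` over the admissible step sizes. -/
noncomputable def muCap (fbar bbar σ β c ρ : ℝ) : ℝ :=
  fbar / ρ + 4 * c * (bbar + ρ) / (σ * (1 - β))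

/-- The regret of one coordinate of the dual variables against `u`, divided by `√T`. -/
noncomputable def dualRate (h ℓ : ℝ → ℝ) (σ κ G W M c₁ c₂ μ₁ u : ℝ) : ℝ :=
  (|h u - h μ₁ - ℓ μ₁ * (u - μ₁)| / c₁ + W * M + c₂ * ((G + 2 * W) * (G + 3 * W) / σ)) / κ

/-- For `η` of order `1 / √T` both `1 / η` and `T * η` are of order `√T`; the constant term is
absorbed since `√T ≥ 1`. -/
theorem DualPath.sum_le_dualRate {h ℓ : ℝ → ℝ} {σ η κ F M G W : ℝ} {T : ℕ} {μ g w : ℕ → ℝ}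
    (P : DualPath h ℓ σ η κ F M G W T μ g w) (hκ : 0 < κ) (hT : 1 ≤ T) {c₁ c₂ M' : ℝ}
    (hc₁ : 0 < c₁) (hη₁ : c₁ / √(T : ℝ) ≤ η) (hη₂ : η ≤ c₂ / √(T : ℝ)) (hM : M ≤ M') {u : ℝ}
    (hu : u ∈ Icc 0 M) {n : ℕ} (hn : n ≤ T) :
    ∑ t ∈ Finset.range n, g t * (μ t - u)
      ≤ dualRate h ℓ σ κ G W M' c₁ c₂ (μ 0) u * √(T : ℝ) := by
  have hT1 : (1 : ℝ) ≤ √(T : ℝ) := Real.one_le_sqrt.2 (by exact_mod_cast hT)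
  have hT0 : 0 < √(T : ℝ) := by linarith
  have hη := P.eta_pos
  have hW := P.W_nonneg
  have hG := P.G_pos
  have hσ := P.sigma_pos
  have hM0 : 0 ≤ M := hu.1.trans hu.2
  rw [div_le_iff₀ hT0] at hη₁
  have hη₂' := (le_div_iff₀ hT0).1 hη₂
  have h1 : |h u - h (μ 0) - ℓ (μ 0) * (u - μ 0)| / η
      ≤ |h u - h (μ 0) - ℓ (μ 0) * (u - μ 0)| / c₁ * √(T : ℝ) := by
    rw [div_mul_eq_mul_div, div_le_div_iff₀ hη hc₁, mul_assoc]
    exact mul_le_mul_of_nonneg_left (by linarith) (abs_nonneg _)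
  have h2 : W * M ≤ W * M' * √(T : ℝ) := by
    have h3 : W * M ≤ W * M' := mul_le_mul_of_nonneg_left hM hW
    have h4 : 0 ≤ W * M := mul_nonneg hW hM0
    nlinarith
  have h3 : n * η ≤ c₂ * √(T : ℝ) := by
    have h4 : (n : ℝ) ≤ √(T : ℝ) * √(T : ℝ) := by
      rw [Real.mul_self_sqrt (Nat.cast_nonneg T)]
      exact_mod_cast hn
    have h5 := mul_le_mul_of_nonneg_right h4 hη.le
    have h6 := mul_le_mul_of_nonneg_left hη₂' hT0.le
    linarith
  have h4 : 0 ≤ (G + 2 * W) * (G + 3 * W) / σ := by positivity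
  have h5 := mul_le_mul_of_nonneg_right h3 h4
  have h6 := P.regret_le hu hn
  rw [dualRate, div_mul_eq_mul_div, le_div_iff₀ hκ, mul_comm _ κ]
  linarith

/-- The constant in the regret bound. -/
noncomputable def regretConst (fbar bbar : ℝ) (ρ : Fin m → ℝ) (h ℓ : Fin m → ℝ → ℝ)
    (σ αD β : ℝ) (μ₁ : Fin m → ℝ) (c₁ c₂ : ℝ) : ℝ :=
  ∑ j, (max
      (dualRate (h j) (ℓ j) σ (1 - αD) (bbar + ρ j) ((bbar + ρ j) / (1 - β))
        (muCap fbar bbar σ β c₂ (ρ j)) c₁ c₂ (μ₁ j) 0)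
      (dualRate (h j) (ℓ j) σ (1 - αD) (bbar + ρ j) ((bbar + ρ j) / (1 - β))
        (muCap fbar bbar σ β c₂ (ρ j)) c₁ c₂ (μ₁ j) (fbar / ρ j))
    + bbar * (fbar / ρ j))

end OnlineAllocation

open OnlineAllocation in
theorem mainTheorem1 {m : ℕ}
    -- bounds on rewards and consumptions; resources per period
    (fbar bbar : ℝ) (hfbar : 0 ≤ fbar) (hbbar : 0 ≤ bbar)
    (ρ : Fin m → ℝ) (hρ : ∀ j, 0 < ρ j)
    -- separable reference function `h(μ) = ∑ j, h j (μ j)` and response functions `ℓ j = (h j)'`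
    (h ℓ : Fin m → ℝ → ℝ)
    (hmono : ∀ j, StrictMonoOn (ℓ j) (Set.Ioi 0)) (hcont : ∀ j, ContinuousOn (ℓ j) (Set.Ioi 0))
    (href : ∀ j, IsReference (h j) (ℓ j))
    (σ : ℝ) (hσ : 0 < σ)
    -- parameters of the controller, with the real-roots condition
    (αI αD β : ℝ) (hβ0 : 0 ≤ β) (hβ1 : β < 1) (hαI : 0 ≤ αI) (hαD : 0 ≤ αD) (hαD1 : αD < 1)
    (hα : αD + αI ≤ 1)
    (hroots : 4 * αD * β * (1 - αI * β) ≤ (αD + β * (1 - αI)) ^ 2)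
    -- initial dual solution, in the domain of the derivative of the reference function
    (μ₁ : Fin m → ℝ) (hμ0 : ∀ j, 0 ≤ μ₁ j) (hμ1 : ∀ j, μ₁ j ≤ fbar / ρ j)
    (hμd : ∀ j, μ₁ j = 0 → HasDerivWithinAt (h j) (ℓ j 0) (Set.Ici 0) 0)
    -- the constants in `η = Θ(T ^ (-1/2))`
    (c₁ c₂ : ℝ) (hc₁ : 0 < c₁) :
    ∃ C : ℝ, ∀ T : ℕ, 1 ≤ T → ∀ η : ℝ, c₁ / √(T : ℝ) ≤ η → η ≤ c₂ / √(T : ℝ) →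
      (∀ j, StrongConvexOn (Set.Icc 0 (muMax fbar bbar σ β η (ρ j))) σ (h j)) →
      ∀ (d : ℕ) (𝒮 : Set (Request d m)) [MeasurableSpace 𝒮],
        (∀ γ ∈ 𝒮, γ.IsRegular fbar bbar) →
        ∀ sel : Request d m → (Fin m → ℝ) → Fin d → ℝ, IsSelection 𝒮 sel →
          -- measurability of the data
          Measurable (fun p : 𝒮 × (Fin m → ℝ) => p.1.1.reward (sel p.1.1 p.2)) →
          Measurable (fun p : 𝒮 × (Fin m → ℝ) => p.1.1.consumption (sel p.1.1 p.2)) →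
          Measurable (fun γ : 𝒮 => γ.1.reward 0) →
          (∀ P : MeasureTheory.ProbabilityMeasure 𝒮,
            AEMeasurable (fun γ : Fin T → 𝒮 =>
                offlineOpt (fun j => ρ j * T) (fun t => (γ t : Request d m)))
              (MeasureTheory.Measure.pi fun _ => (P : MeasureTheory.Measure 𝒮))) →
          -- the expectations exist, and the regret is at most `C T ^ (1/2)`
          (∀ P : MeasureTheory.ProbabilityMeasure 𝒮,
            MeasureTheory.Integrable (fun γ : Fin T → 𝒮 =>
                gap (pidInput ρ ℓ αI αD β μ₁ T η) sel (fun t => (γ t : Request d m)))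
              (MeasureTheory.Measure.pi fun _ => (P : MeasureTheory.Measure 𝒮))) ∧
          regret (pidInput ρ ℓ αI αD β μ₁ T η) sel 𝒮 ≤ ((C * √(T : ℝ) : ℝ) : EReal) := by
  refine ⟨regretConst fbar bbar ρ h ℓ σ αD β μ₁ c₁ c₂, ?_⟩
  intro T hT η hη₁ hη₂ hsc d 𝒮 _ hreg sel hsel hr hb hr0 hopt
  have hT1 : (1 : ℝ) ≤ √(T : ℝ) := Real.one_le_sqrt.2 (by exact_mod_cast hT)
  have hT0 : 0 < √(T : ℝ) := by linarith
  have hTR : (0 : ℝ) < T := by exact_mod_cast hT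
  have hη : 0 < η := (div_pos hc₁ hT0).trans_le hη₁
  -- Makes `muMax` bounded by `muCap`, which does not depend on `T`.
  have hηc : η ≤ c₂ := by
    have := (le_div_iff₀ hT0).1 hη₂
    nlinarith
  have hβ : 0 < 1 - β := by linarith
  have hF : ∀ j, 0 ≤ fbar / ρ j := fun j => div_nonneg hfbar (hρ j).le
  have hcap : ∀ j, muMax fbar bbar σ β η (ρ j) ≤ muCap fbar bbar σ β c₂ (ρ j) := fun j => by
    have := hρ j
    unfold muMax muCap
    gcongr
  have hBT : ∀ j, ρ j * (T : ℝ) / T = ρ j := fun j => mul_div_cancel_right₀ _ hTR.ne'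
  set A := pidInput ρ ℓ αI αD β μ₁ T η with hA
  have hpath : ∀ (ω : Fin A.T → 𝒮) (j : Fin m), DualPath (h j) (ℓ j) σ η (1 - αD) (fbar / ρ j)
      (muMax fbar bbar σ β η (ρ j)) (bbar + ρ j) ((bbar + ρ j) / (1 - β)) T
      (fun t => (trajectory A sel (fun i => (ω i).1) t).μ j)
      (fun t => ρ j - spent A sel (fun i => (ω i).1) t j)
      (fun t => αD * (trajectory A sel (fun i => (ω i).1) t).err t j
        - αI * β * integralTerm A sel (fun i => (ω i).1) t j) := fun ω j =>
    dualPath (A := A) hfbar hbbar hρ hmono hcont href hσ hβ0 hβ1 hαI hαD hα hμ0 hμ1 hμd hη hBT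
      rfl rfl rfl hsc hreg hsel (fun t => (ω t).2) j
  have hD : ∀ (ω : Fin A.T → 𝒮) (j : Fin m), ∀ n ≤ A.T, ∀ u, u = 0 ∨ u = fbar / ρ j →
      ∑ t ∈ Finset.range n, (ρ j - spent A sel (fun i => (ω i).1) t j)
        * ((trajectory A sel (fun i => (ω i).1) t).μ j - u)
      ≤ max
        (dualRate (h j) (ℓ j) σ (1 - αD) (bbar + ρ j) ((bbar + ρ j) / (1 - β))
          (muCap fbar bbar σ β c₂ (ρ j)) c₁ c₂ (μ₁ j) 0)
        (dualRate (h j) (ℓ j) σ (1 - αD) (bbar + ρ j) ((bbar + ρ j) / (1 - β))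
          (muCap fbar bbar σ β c₂ (ρ j)) c₁ c₂ (μ₁ j) (fbar / ρ j)) * √(T : ℝ) := by
    intro ω j n hn u hu
    have hP := hpath ω j
    have hFM := hP.F_lt_M
    have hmem : u ∈ Set.Icc 0 (muMax fbar bbar σ β η (ρ j)) := by
      rcases hu with rfl | rfl
      · exact ⟨le_rfl, (hF j).trans hFM.le⟩
      · exact ⟨hF j, hFM.le⟩
    refine (hP.sum_le_dualRate (by linarith) hT hc₁ hη₁ hη₂ (hcap j) hmem hn).trans ?_
    refine mul_le_mul_of_nonneg_right ?_ hT0.le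
    rcases hu with rfl | rfl
    · exact le_max_left _ _
    · exact le_max_right _ _
  have key := fun P : MeasureTheory.ProbabilityMeasure 𝒮 =>
    integrable_gap_and_integral_gap_le (A := A) hreg hsel hr hb hr0 hcont hμ0
      (fun j => mul_nonneg (hρ j).le hTR.le) hT P (hopt P)
      (M := fun j => muMax fbar bbar σ β η (ρ j))
      (fun ω t j => ((hpath ω j).mem_Icc t.2.le).2)
      (R := regretConst fbar bbar ρ h ℓ σ αD β μ₁ c₁ c₂ * √(T : ℝ)) (fun ω => by
        have h1 := sum_slackness_le (A := A) hfbar hbbar hρ (fun j => rfl) hreg hsel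
          (fun t => (ω t).2) hμ0 (hD ω)
        have h2 : ∀ j, A.B j / A.T = ρ j := hBT
        simp only [h2]
        refine h1.trans ?_
        rw [regretConst, Finset.sum_mul]
        refine Finset.sum_le_sum fun j _ => ?_
        rw [add_mul]
        -- The additive term `bbar * (fbar / ρ j)` is absorbed by `√T ≥ 1`.
        have h3 : 0 ≤ bbar * (fbar / ρ j) := mul_nonneg hbbar (hF j)
        nlinarith)
  refine ⟨fun P => (key P).1, iSup_le fun P => EReal.coe_le_coe_iff.2 (key P).2⟩
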